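/- Let $d\ge 1$. For $n\ge 1$ let $B_n$ be the braid group with the standard generators $\sigma_1,\dots,\sigma_{n-1}$, let $\epsilon:B_n\to\mathbb Z$ be the exponent sum, and for $\alpha\in B_n$ let $\alpha^*$ be its mirror image, i.e. the image of $\alpha$ under the automorphism $\sigma_i\mapsto\sigma_i^{-1}$. Let $\widehat\alpha$ denote the closure of $\alpha$; the closure $\widehat{\alpha^*}$ is the mirror image of $\widehat\alpha$. Let $\mathcal F_{d,n}$ be the modular framed braid group, generated by $\sigma_1,\dots,\sigma_{n-1},t_1,\dots,t_n$ with the braid relations, $t_it_j=t_jt_i$, $t_j\sigma_i=\sigma_i t_{s_i(j)}$ (with $s_i$ the transposition $(i,i+1)$) and $t_j^d=1$. For $q\in\mathbb C\setminus\{0\}$ the Yokonuma--Hecke algebra $Y_{d,n}(q)$ is the quotient of $\mathbb C\mathcal F_{d,n}$ by the two-sided ideal generated by the elements $\sigma_i^2-1-(q-q^{-1})e_i\sigma_i$ $(1\le i\le n-1)$, where $e_i=\frac1d\sum_{s=1}^d t_i^{s}t_{i+1}^{-s}$. Write $g_i$ for the image of $\sigma_i$, and $\delta:B_n\to Y_{d,n}(q)$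 for the homomorphism $\sigma_i\mapsto g_i$. Let $X_D=(\mathrm x_1,\dots,\mathrm x_{d-1})\in\mathbb C^{d-1}$ be a solution of the E-system (such solutions are parametrized by the non-empty subsets $D$ of $\mathbb Z/d\mathbb Z$): with $\mathrm x_0=1$, subscripts modulo $d$, and $E^{(m)}=\frac1d\sum_{s=0}^{d-1}\mathrm x_{m+s}\mathrm x_{d-s}$, one has $E^{(m)}=\mathrm x_mE^{(0)}$ for $1\le m\le d-1$. Let $\mathrm{tr}_{d,D}:\bigcup_nY_{d,n}(q)\to\mathbb C[z]$ be the specialized trace, i.e. the unique linear map such that for all $n\geq 1$ 1. $\mathrm{tr}_{d,D}(ab)=\mathrm{tr}_{d,D}(ba)$ for $a,b\in Y_{d,n}(q)$; 2. $\mathrm{tr}_{d,D}(1)=1$; 3. $\mathrm{tr}_{d,D}(a g_n)=z\,\mathrm{tr}_{d,D}(a)$ for $a\in Y_{d,n}(q)$; 4. $\mathrm{tr}_{d,D}(a t_{n+1}^s)=\mathrm x_s\,\mathrm{tr}_{d,D}(a)$ for $a\in Y_{d,n}(q)$ and $1\le s\le d-1$; and likewise $\mathrm{tr}_{d,D}(t_1^s)=\mathrm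 x_s$ for $1\le s\le d-1$. Put $E_D=E^{(0)}=\mathrm{tr}_{d,D}(e_i)$. For $z\in\mathbb C$, $z\ne0$, put $$\lambda_D=\frac{z-(q-q^{-1})E_D}{z},$$ and, if $\lambda_D\ne0$ and a square root $\sqrt{\lambda_D}$ has been chosen, put $$\Lambda_D=\frac1{z\sqrt{\lambda_D}},\qquad \Theta_{d,D}(q,z)(\widehat\alpha)=\Lambda_D^{\,n-1}\,(\sqrt{\lambda_D})^{\epsilon(\alpha)}\;\mathrm{tr}_{d,D}(\delta(\alpha))\qquad(\alpha\in B_n),$$ the trace being evaluated at $z$. For $q^2\ne1$ and $\lambda_D\ne0,1$ write $\Theta_{d,D}(q,\lambda_D)$ for the same quantity in the variables $(q,\lambda_D)$, that is, at $z=\dfrac{(q-q^{-1})E_D}{1-\lambda_D}$. **Proposition.** Let $X_D$ be a solution of the E-system and let $\alpha\in B_n$. (i) Let $q,z\in\mathbb C\setminus\{0\}$ with $z\ne(q-q^{-1})E_D$, and let $\sqrt{\lambda_D}$ be a square root of $\lambda_D=\lambda_D(q,z)$. The value of $\lambda_D$ at $(q^{-1},z-(q-q^{-1})E_D)$ is $\lambda_D^{-1}$;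 taking $1/\sqrt{\lambda_D}$ as its square root, $$\Theta_{d,D}(q,z)(\widehat{\alpha^*})=\Theta_{d,D}\bigl(q^{-1},\,z-(q-q^{-1})E_D\bigr)(\widehat\alpha).$$ (ii) Equivalently, in the variables $(q,\lambda_D)$: for $q\in\mathbb C\setminus\{0\}$ with $q^2\ne1$, $\lambda_D\in\mathbb C\setminus\{0,1\}$, and any square root $\sqrt{\lambda_D}$, with $1/\sqrt{\lambda_D}$ as the square root of $\lambda_D^{-1}$, $$\Theta_{d,D}(q,\lambda_D)(\widehat{\alpha^*})=\Theta_{d,D}(q^{-1},\lambda_D^{-1})(\widehat\alpha).$$ -/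

import Mathlib

open scoped Polynomial

noncomputable section

namespace YH

/-! ### Braid groups -/

/-- The generators `σ_i` of the braid group on `n` strands. Strands are numbered `0, …, n - 1`, and
`σ_i` involves the strands `i` and `i + 1`. -/
abbrev BraidGen (n : ℕ) : Type := {i : ℕ // i + 1 < n}

/-- The braid relations. -/
inductive BraidRel (n : ℕ) : FreeGroup (BraidGen n) → Prop
  | braid (i j : BraidGen n) (h : i.1 + 1 = j.1 ∨ j.1 + 1 = i.1) :
      BraidRel n (.of i * .of j * .of i * (.of j * .of i * .of j)⁻¹)
  | far (i j : BraidGen n) (h : i.1 + 1 < j.1 ∨ j.1 + 1 < i.1) :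
      BraidRel n (.of i * .of j * (.of j * .of i)⁻¹)

/-- The classical braid group `B_n`. -/
abbrev BraidGroup (n : ℕ) : Type := PresentedGroup {r | BraidRel n r}

/-- The braid generator `σ_i` as an element of `B_n`. -/
def σ {n : ℕ} (i : BraidGen n) : BraidGroup n := PresentedGroup.of i

theorem σ_braid {n : ℕ} (i j : BraidGen n) (h : i.1 + 1 = j.1 ∨ j.1 + 1 = i.1) :
    σ i * σ j * σ i = σ j * σ i * σ j :=
  PresentedGroup.mk_eq_mk_of_mul_inv_mem (BraidRel.braid i j h)

theorem σ_far {n : ℕ} (i j : BraidGen n) (h : i.1 + 1 < j.1 ∨ j.1 + 1 < i.1) :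
    σ i * σ j = σ j * σ i :=
  PresentedGroup.mk_eq_mk_of_mul_inv_mem (BraidRel.far i j h)

/-- A group homomorphism out of `B_n`, given by the images of the generators. -/
def BraidGroup.lift {n : ℕ} {G : Type*} [Group G] (f : BraidGen n → G)
    (hb : ∀ i j : BraidGen n, i.1 + 1 = j.1 ∨ j.1 + 1 = i.1 → f i * f j * f i = f j * f i * f j)
    (hf : ∀ i j : BraidGen n, i.1 + 1 < j.1 ∨ j.1 + 1 < i.1 → f i * f j = f j * f i) :
    BraidGroup n →* G :=
  PresentedGroup.toGroup (f := f) (by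
    rintro r (⟨i, j, h⟩ | ⟨i, j, h⟩)
    · simp [hb i j h]
    · simp [hf i j h])

@[simp] theorem BraidGroup.lift_σ {n : ℕ} {G : Type*} [Group G] (f : BraidGen n → G) (hb) (hf)
    (i : BraidGen n) : BraidGroup.lift f hb hf (σ i) = f i :=
  PresentedGroup.toGroup.of _

/-- The mirror image `α ↦ α^*`: the endomorphism of `B_n` with `σ_i ↦ σ_i⁻¹`. -/
def mirror (n : ℕ) : BraidGroup n →* BraidGroup n :=
  BraidGroup.lift (fun i => (σ i)⁻¹)
    (fun i j h => by simpa [mul_assoc] using congrArg (·⁻¹) (σ_braid i j h))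
    (fun i j h => by simpa using congrArg (·⁻¹) (σ_far j i h.symm))

/-- The exponent sum, as a homomorphism to the (multiplicative) group of integers. -/
def exponentSumHom (n : ℕ) : BraidGroup n →* Multiplicative ℤ :=
  BraidGroup.lift (fun _ => Multiplicative.ofAdd 1) (fun _ _ _ => rfl) (fun _ _ _ => rfl)

/-- The algebraic sum `ε(α)` of the exponents of the generators `σ_i` in the braid `α`. -/
def exponentSum {n : ℕ} (α : BraidGroup n) : ℤ := Multiplicative.toAdd (exponentSumHom n α)

/-! ### The modular framed braid group -/

/-- The generators of the (modular) framed braid group: the braiding generators `σ_i` and the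
framing generators `t_j`. -/
inductive FramedGen (n : ℕ) : Type
  | sigma (i : BraidGen n) : FramedGen n
  | twist (j : Fin n) : FramedGen n

/-- The relations of the modular framed braid group. -/
inductive FramedRel (d n : ℕ) : FreeGroup (FramedGen n) → Prop
  | braid (i j : BraidGen n) (h : i.1 + 1 = j.1 ∨ j.1 + 1 = i.1) :
      FramedRel d n (.of (.sigma i) * .of (.sigma j) * .of (.sigma i) *
        (.of (.sigma j) * .of (.sigma i) * .of (.sigma j))⁻¹)
  | far (i j : BraidGen n) (h : i.1 + 1 < j.1 ∨ j.1 + 1 < i.1) :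
      FramedRel d n (.of (.sigma i) * .of (.sigma j) * (.of (.sigma j) * .of (.sigma i))⁻¹)
  | twist_comm (i j : Fin n) :
      FramedRel d n (.of (.twist i) * .of (.twist j) * (.of (.twist j) * .of (.twist i))⁻¹)
  | twist_sigma (i : BraidGen n) (j k : Fin n) (h : k.1 = Equiv.swap i.1 (i.1 + 1) j.1) :
      FramedRel d n (.of (.twist j) * .of (.sigma i) * (.of (.sigma i) * .of (.twist k))⁻¹)
  | modular (j : Fin n) : FramedRel d n (.of (.twist j) ^ d)

/-- The modular framed braid group `F_{d,n} ≅ (ℤ/dℤ)^n ⋊ B_n`. -/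
abbrev FramedBraidGroup (d n : ℕ) : Type := PresentedGroup {r | FramedRel d n r}

/-- The generator `σ_i` of `F_{d,n}`. -/
def fσ (d : ℕ) {n : ℕ} (i : BraidGen n) : FramedBraidGroup d n := PresentedGroup.of (.sigma i)

/-- The generator `t_j` of `F_{d,n}`: framing `1` on the strand `j`. -/
def ft (d : ℕ) {n : ℕ} (j : Fin n) : FramedBraidGroup d n := PresentedGroup.of (.twist j)

theorem fσ_braid {d n : ℕ} (i j : BraidGen n) (h : i.1 + 1 = j.1 ∨ j.1 + 1 = i.1) :
    fσ d i * fσ d j * fσ d i = fσ d j * fσ d i * fσ d j :=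
  PresentedGroup.mk_eq_mk_of_mul_inv_mem (FramedRel.braid i j h)

theorem fσ_far {d n : ℕ} (i j : BraidGen n) (h : i.1 + 1 < j.1 ∨ j.1 + 1 < i.1) :
    fσ d i * fσ d j = fσ d j * fσ d i :=
  PresentedGroup.mk_eq_mk_of_mul_inv_mem (FramedRel.far i j h)

theorem ft_comm {d n : ℕ} (i j : Fin n) : ft d i * ft d j = ft d j * ft d i :=
  PresentedGroup.mk_eq_mk_of_mul_inv_mem (FramedRel.twist_comm i j)

theorem ft_fσ {d n : ℕ} (i : BraidGen n) (j k : Fin n)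
    (h : k.1 = Equiv.swap i.1 (i.1 + 1) j.1) : ft d j * fσ d i = fσ d i * ft d k :=
  PresentedGroup.mk_eq_mk_of_mul_inv_mem (FramedRel.twist_sigma i j k h)

theorem ft_pow {d n : ℕ} (j : Fin n) : ft d j ^ d = 1 :=
  PresentedGroup.one_of_mem (FramedRel.modular j)

/-- The natural homomorphism `B_n → F_{d,n}`: all framings are zero. -/
def braidToFramed (d n : ℕ) : BraidGroup n →* FramedBraidGroup d n :=
  BraidGroup.lift (fun i => fσ d i) (fun i j h => fσ_braid i j h) (fun i j h => fσ_far i j h)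

/-! ### The Yokonuma--Hecke algebra -/

section Algebra

variable (R : Type) [CommRing R] [Algebra ℂ R]

/-- The left strand of the generator `σ_i`. -/
def BraidGen.left {n : ℕ} (i : BraidGen n) : Fin n := ⟨i.1, by have := i.2; omega⟩

/-- The right strand of the generator `σ_i`. -/
def BraidGen.right {n : ℕ} (i : BraidGen n) : Fin n := ⟨i.1 + 1, i.2⟩

/-- The element `e_i = (1/d) ∑_{1 ≤ s ≤ d} t_i^s t_{i+1}^{-s}` of the group algebra of `F_{d,n}`. -/
def idem (d : ℕ) {n : ℕ} (i : BraidGen n) : MonoidAlgebra R (FramedBraidGroup d n) :=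
  algebraMap ℂ R (d : ℂ)⁻¹ • ∑ s ∈ Finset.Icc 1 d,
    MonoidAlgebra.of R _ (ft d i.left ^ s * (ft d i.right ^ s)⁻¹)

/-- The quadratic relations `σ_i ^ 2 = 1 + (q - q⁻¹) e_i σ_i` in the group algebra of `F_{d,n}`. -/
inductive QuadRel (d n : ℕ) (q : Rˣ) :
    MonoidAlgebra R (FramedBraidGroup d n) → MonoidAlgebra R (FramedBraidGroup d n) → Prop
  | quad (i : BraidGen n) :
      QuadRel d n q (MonoidAlgebra.of R _ (fσ d i) ^ 2)
        (1 + ((q : R) - ((q⁻¹ : Rˣ) : R)) • (idem R d i * MonoidAlgebra.of R _ (fσ d i)))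

/-- The Yokonuma--Hecke algebra `Y_{d,n}(q)` with coefficients in a commutative `ℂ`-algebra `R`: the
quotient of the group algebra of `F_{d,n}` by the two-sided ideal generated by the elements
`σ_i ^ 2 - 1 - (q - q⁻¹) e_i σ_i`. -/
def Y (d n : ℕ) (q : Rˣ) : Type := RingQuot (QuadRel R d n q)

instance (d n : ℕ) (q : Rˣ) : Ring (Y R d n q) := inferInstanceAs (Ring (RingQuot (QuadRel R d n q)))

instance (S : Type) [CommSemiring S] [Algebra S R] (d n : ℕ) (q : Rˣ) : Algebra S (Y R d n q) :=
  inferInstanceAs (Algebra S (RingQuot (QuadRel R d n q)))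

instance (S T : Type) [CommSemiring S] [CommSemiring T] [SMul S T] [Algebra S R] [Algebra T R]
    [IsScalarTower S T R] (d n : ℕ) (q : Rˣ) : IsScalarTower S T (Y R d n q) :=
  inferInstanceAs (IsScalarTower S T (RingQuot (QuadRel R d n q)))

/-- The quotient map from the group algebra. -/
def mkY (d n : ℕ) (q : Rˣ) : MonoidAlgebra R (FramedBraidGroup d n) →ₐ[R] Y R d n q :=
  RingQuot.mkAlgHom R (QuadRel R d n q)

/-- The natural map `F_{d,n} → Y_{d,n}(q)`. -/
def framedToY (d n : ℕ) (q : Rˣ) : FramedBraidGroup d n →* Y R d n q :=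
  (mkY R d n q : _ →* Y R d n q).comp (MonoidAlgebra.of R _)

/-- The natural map `B_n → Y_{d,n}(q)`, `σ_i ↦ g_i`. -/
def braidToY (d n : ℕ) (q : Rˣ) : BraidGroup n →* Y R d n q :=
  (framedToY R d n q).comp (braidToFramed d n)

variable {R} {d n : ℕ} {q : Rˣ}

/-- The generator `g_i` of `Y_{d,n}(q)`. -/
def g (d : ℕ) {n : ℕ} (q : Rˣ) (i : BraidGen n) : Y R d n q := framedToY R d n q (fσ d i)

/-- The generator `t_j` of `Y_{d,n}(q)`. -/
def t (d : ℕ) {n : ℕ} (q : Rˣ) (j : Fin n) : Y R d n q := framedToY R d n q (ft d j)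

/-! ### Representations of the generators -/

theorem t_comm (i j : Fin n) : t d q i * t d q j = t d q j * t d q i := by
  simp only [t, ← map_mul, ft_comm]

theorem t_pow (j : Fin n) : t d q j ^ d = 1 := by
  simp only [t, ← map_pow, ft_pow, map_one]

theorem t_inv (j : Fin n) (s : ℕ) (hs : s ≤ d) :
    framedToY R d n q (ft d j ^ s)⁻¹ = t d q j ^ (d - s) := by
  have : (ft d j ^ s)⁻¹ = ft d j ^ (d - s) := by
    rw [inv_eq_iff_mul_eq_one, ← pow_add, Nat.add_sub_cancel' hs, ft_pow]
  rw [this, map_pow, t]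

theorem pow_val_add {d : ℕ} [NeZero d] {B : Type} [Monoid B] {x : B} (hx : x ^ d = 1) (a b : ZMod d) :
    x ^ (a + b).val = x ^ a.val * x ^ b.val := by
  rw [← pow_add, ZMod.val_add, ← pow_mod_orderOf x, ← pow_mod_orderOf x (a.val + b.val)]
  congr 1
  exact Nat.mod_mod_of_dvd _ (orderOf_dvd_of_pow_eq_one hx)

theorem pow_val_natCast {d : ℕ} {B : Type} [Monoid B] {x : B} (hx : x ^ d = 1) (s : ℕ) :
    x ^ (s : ZMod d).val = x ^ s := by
  rw [ZMod.val_natCast, ← pow_mod_orderOf x, ← pow_mod_orderOf x s]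
  congr 1
  exact Nat.mod_mod_of_dvd _ (orderOf_dvd_of_pow_eq_one hx)

theorem pow_val_neg {d : ℕ} {B : Type} [Monoid B] {x : B} (hx : x ^ d = 1) (s : ℕ) (hs : s ≤ d) :
    x ^ (-(s : ZMod d)).val = x ^ (d - s) := by
  rw [← pow_val_natCast hx (d - s), Nat.cast_sub hs]
  simp

theorem sum_Icc_eq_sum_zmod {d : ℕ} [NeZero d] {M : Type*} [AddCommMonoid M] (f : ZMod d → M) :
    ∑ s ∈ Finset.Icc 1 d, f (s : ZMod d) = ∑ s : ZMod d, f s := by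
  have hd : 0 < d := Nat.pos_of_ne_zero (NeZero.ne d)
  refine Finset.sum_bij (fun s _ => (s : ZMod d)) (by simp) ?_ ?_ (by simp)
  · intro a ha b hb h
    simp only [Finset.mem_Icc] at ha hb
    have h' := (ZMod.natCast_eq_natCast_iff _ _ _).1 h
    rcases Nat.lt_or_ge a d with h1 | h1 <;> rcases Nat.lt_or_ge b d with h2 | h2
    · exact Nat.ModEq.eq_of_lt_of_lt h' h1 h2
    · have : b = d := by omega
      subst this
      have := (Nat.modEq_zero_iff_dvd).1 (h'.trans (by simp [Nat.ModEq]))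
      have := Nat.le_of_dvd (by omega) this
      omega
    · have : a = d := by omega
      subst this
      have := (Nat.modEq_zero_iff_dvd).1 (h'.symm.trans (by simp [Nat.ModEq]))
      have := Nat.le_of_dvd (by omega) this
      omega
    · omega
  · intro b _
    by_cases hb : b = 0
    · exact ⟨d, by simp; omega, by simp [hb]⟩
    · refine ⟨b.val, ?_, by simp⟩
      have := ZMod.val_lt b
      have h0 : b.val ≠ 0 := by simpa using hb
      simp; omega

/-- The scalar `1/d`. -/
def invd (R : Type) [CommRing R] [Algebra ℂ R] (d : ℕ) : R := algebraMap ℂ R (d : ℂ)⁻¹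

/-- The values of the standard character of `ℤ/dℤ`. -/
def chi (R : Type) [CommRing R] [Algebra ℂ R] {d : ℕ} [NeZero d] (a : ZMod d) : R :=
  algebraMap ℂ R (ZMod.stdAddChar a)

section Rep

variable {B : Type} [Ring B] [Algebra R B]

/-- The idempotent built from two commuting elements of order `d`. -/
def eB (R : Type) [CommRing R] [Algebra ℂ R] {B : Type} [Ring B] [Algebra R B]
    (d : ℕ) [NeZero d] (x y : B) : B :=
  invd R d • ∑ s : ZMod d, x ^ s.val * y ^ (-s).val

/-- Elements `g 0, …, g (n - 2)` and `t 0, …, t (n - 1)` satisfying the relations of the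
Yokonuma--Hecke algebra with parameter `v = q - q⁻¹`. -/
structure IsRep (d : ℕ) [NeZero d] (n : ℕ) (v : R) (g t : ℕ → B) : Prop where
  braid : ∀ i, i + 2 < n → g i * g (i + 1) * g i = g (i + 1) * g i * g (i + 1)
  far : ∀ i j, i + 1 < j → j + 1 < n → g i * g j = g j * g i
  tt : ∀ i j, i < n → j < n → t i * t j = t j * t i
  tg0 : ∀ i, i + 1 < n → t i * g i = g i * t (i + 1)
  tg1 : ∀ i, i + 1 < n → t (i + 1) * g i = g i * t i
  tg : ∀ i j, i + 1 < n → j < n → j ≠ i → j ≠ i + 1 → t j * g i = g i * t j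
  td : ∀ j, j < n → t j ^ d = 1
  quad : ∀ i, i + 1 < n → g i * g i = 1 + v • (eB R d (t i) (t (i + 1)) * g i)

section
variable [NeZero d]

theorem mkAlgHom_idem (i : BraidGen n) :
    mkY R d n q (idem R d i) =
      eB R d (t d q i.left : Y R d n q) (t d q i.right) := by
  rw [eB, idem, map_smul, map_sum, invd, ← sum_Icc_eq_sum_zmod]
  congr 1
  refine Finset.sum_congr rfl fun s hs => ?_
  have hs' : s ≤ d := (Finset.mem_Icc.1 hs).2
  change framedToY R d n q _ = _
  rw [map_mul, t_inv _ _ hs', map_pow, pow_val_natCast (t_pow _), pow_val_neg (t_pow _) _ hs']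
  rfl
/-- `g` on natural numbers, zero out of range. -/
def gT (d n : ℕ) (q : Rˣ) (i : ℕ) : Y R d n q := if h : i + 1 < n then g d q ⟨i, h⟩ else 0

/-- `t` on natural numbers, zero out of range. -/
def tT (d n : ℕ) (q : Rˣ) (j : ℕ) : Y R d n q := if h : j < n then t d q ⟨j, h⟩ else 0

theorem gT_eq (i : ℕ) (h : i + 1 < n) : gT d n q i = g d q ⟨i, h⟩ := dif_pos h

theorem tT_eq (j : ℕ) (h : j < n) : tT d n q j = t d q ⟨j, h⟩ := dif_pos h

theorem isRep_Y : IsRep (B := Y R d n q) d n ((q : R) - ((q⁻¹ : Rˣ) : R)) (gT d n q) (tT d n q) where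
  braid i h := by
    rw [gT_eq i (by omega), gT_eq (i + 1) (by omega)]
    simp only [g, ← map_mul]
    rw [fσ_braid _ _ (Or.inl rfl)]
  far i j h h' := by
    rw [gT_eq i (by omega), gT_eq j (by omega)]
    simp only [g, ← map_mul]
    rw [fσ_far _ _ (Or.inl h)]
  tt i j h h' := by
    rw [tT_eq i h, tT_eq j h', t_comm]
  tg0 i h := by
    rw [tT_eq i (by omega), tT_eq (i + 1) h, gT_eq i h]
    simp only [g, t, ← map_mul]
    rw [ft_fσ _ _ ⟨i + 1, h⟩ (by simp)]
  tg1 i h := by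
    rw [tT_eq i (by omega), tT_eq (i + 1) h, gT_eq i h]
    simp only [g, t, ← map_mul]
    rw [ft_fσ _ _ ⟨i, by omega⟩ (by simp)]
  tg i j h h' h1 h2 := by
    rw [tT_eq j h', gT_eq i h]
    simp only [g, t, ← map_mul]
    rw [ft_fσ _ _ ⟨j, h'⟩ (by simp [Equiv.swap_apply_of_ne_of_ne h1 h2])]
  td j h := by rw [tT_eq j h, t_pow]
  quad i h := by
    rw [tT_eq i (by omega), tT_eq (i + 1) h, gT_eq i h]
    have : mkY R d n q _ = mkY R d n q _ :=
      RingQuot.mkAlgHom_rel R (QuadRel.quad (d := d) (q := q) (⟨i, h⟩ : BraidGen n))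
    rw [map_pow, map_add, map_one, map_smul, map_mul, mkAlgHom_idem, pow_two] at this
    exact this

namespace IsRep

variable {v : R} {gg tt : ℕ → B}

theorem e_comm (H : IsRep d n v gg tt) (i : ℕ) (h : i + 1 < n) :
    eB R d (tt i) (tt (i + 1)) * gg i = gg i * eB R d (tt i) (tt (i + 1)) := by
  have h0 : ∀ s : ℕ, tt i ^ s * gg i = gg i * tt (i + 1) ^ s := fun s => by
    have : SemiconjBy (gg i) (tt (i + 1)) (tt i) := (H.tg0 i h).symm
    exact (this.pow_right s).symm
  have h1 : ∀ s : ℕ, tt (i + 1) ^ s * gg i = gg i * tt i ^ s := fun s => by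
    have : SemiconjBy (gg i) (tt i) (tt (i + 1)) := (H.tg1 i h).symm
    exact (this.pow_right s).symm
  rw [eB, smul_mul_assoc, mul_smul_comm, Finset.sum_mul, Finset.mul_sum]
  congr 1
  refine Fintype.sum_equiv (Equiv.neg _) _ _ fun s => ?_
  have hc : Commute (tt (i + 1)) (tt i) := H.tt _ _ h (by omega)
  simp only [Equiv.neg_apply, neg_neg]
  rw [mul_assoc, h1, ← mul_assoc, h0, mul_assoc, (hc.pow_pow _ _).eq]

/-- The generators are invertible. -/
def unit (H : IsRep d n v gg tt) (i : ℕ) (h : i + 1 < n) : Bˣ where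
  val := gg i
  inv := gg i - v • eB R d (tt i) (tt (i + 1))
  val_inv := by
    rw [mul_sub, H.quad i h, mul_smul_comm, H.e_comm i h]; simp
  inv_val := by
    rw [sub_mul, H.quad i h, smul_mul_assoc]; simp

/-- The framing generators are invertible. -/
def tunit (H : IsRep d n v gg tt) (j : ℕ) (h : j < n) : Bˣ := Units.ofPowEqOne (tt j) d (H.td j h) (NeZero.ne d)

/-- The homomorphism from the framed braid group given by a representation. -/
def groupHom (H : IsRep d n v gg tt) : FramedBraidGroup d n →* Bˣ :=
  PresentedGroup.toGroup
    (f := fun x => match x with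
      | .sigma i => H.unit i.1 i.2
      | .twist j => H.tunit j.1 j.2) (by
    rintro r (⟨i, j, h⟩ | ⟨i, j, h⟩ | ⟨i, j⟩ | ⟨⟨i, hi⟩, ⟨j, hj⟩, ⟨k, hk⟩, h⟩ | ⟨j⟩)
    · simp only [map_mul, map_inv, FreeGroup.lift_apply_of, mul_inv_eq_one]
      ext
      simp only [Units.val_mul, unit]
      rcases h with h | h
      · rw [← h]; exact H.braid _ (by have := j.2; omega)
      · rw [← h]; exact (H.braid _ (by have := i.2; omega)).symm
    · simp only [map_mul, map_inv, FreeGroup.lift_apply_of, mul_inv_eq_one]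
      ext
      simp only [Units.val_mul, unit]
      rcases h with h | h
      · exact H.far _ _ h j.2
      · exact (H.far _ _ h i.2).symm
    · simp only [map_mul, map_inv, FreeGroup.lift_apply_of, mul_inv_eq_one]
      ext
      exact H.tt _ _ i.2 j.2
    · simp only [map_mul, map_inv, FreeGroup.lift_apply_of, mul_inv_eq_one]
      ext
      change tt j * gg i = gg i * tt k
      simp only at h
      by_cases h1 : j = i
      · subst h1; simp at h; subst h; exact H.tg0 _ hi
      by_cases h2 : j = i + 1
      · subst h2; simp at h; subst h; exact H.tg1 _ hi
      · rw [Equiv.swap_apply_of_ne_of_ne h1 h2] at h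
        subst h; exact H.tg _ _ hi hj h1 h2
    · simp only [map_pow, FreeGroup.lift_apply_of]
      ext
      simp [tunit])

end IsRep

/-- The universal property of the Yokonuma--Hecke algebra. -/
def Y.lift {gg tt : ℕ → B} (H : IsRep d n ((q : R) - ((q⁻¹ : Rˣ) : R)) gg tt) : Y R d n q →ₐ[R] B :=
  RingQuot.liftAlgHom R ⟨MonoidAlgebra.lift R B _ ((Units.coeHom B).comp H.groupHom), by
    rintro _ _ ⟨i⟩
    have hg : MonoidAlgebra.lift R B _ ((Units.coeHom B).comp H.groupHom)
        (MonoidAlgebra.of R _ (fσ d i)) = gg i.1 := by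
      rw [MonoidAlgebra.lift_of, MonoidHom.comp_apply, IsRep.groupHom, fσ, PresentedGroup.toGroup.of]
      rfl
    have ht : ∀ j : Fin n, H.groupHom (ft d j) = H.tunit j.1 j.2 := fun j => by
      rw [IsRep.groupHom, ft, PresentedGroup.toGroup.of]
    have hi : ∀ (j : Fin n) (s : ℕ), s ≤ d →
        (((H.tunit j.1 j.2) ^ s)⁻¹ : Bˣ) = (H.tunit j.1 j.2) ^ (d - s) := fun j s hs => by
      rw [inv_eq_iff_mul_eq_one, ← pow_add, Nat.add_sub_cancel' hs]
      ext
      simp [IsRep.tunit]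
    have he : MonoidAlgebra.lift R B _ ((Units.coeHom B).comp H.groupHom) (idem R d i) =
        eB R d (tt i.1) (tt (i.1 + 1)) := by
      rw [eB, idem, map_smul, map_sum, invd, ← sum_Icc_eq_sum_zmod]
      congr 1
      refine Finset.sum_congr rfl fun s hs => ?_
      have hs' : s ≤ d := (Finset.mem_Icc.1 hs).2
      rw [MonoidAlgebra.lift_of, MonoidHom.comp_apply, map_mul, map_inv, map_pow, map_pow, ht, ht,
        hi _ _ hs', pow_val_natCast (H.td i.1 (i.left).2),
        pow_val_neg (H.td (i.1 + 1) i.2) _ hs']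
      rfl
    rw [map_pow, hg, map_add, map_one, map_smul, map_mul, hg, he, pow_two, H.quad _ i.2]⟩

theorem Y.lift_g {gg tt : ℕ → B} (H : IsRep d n ((q : R) - ((q⁻¹ : Rˣ) : R)) gg tt)
    (i : BraidGen n) : Y.lift H (g d q i) = gg i.1 := by
  change Y.lift H (RingQuot.mkAlgHom R (QuadRel R d n q) (MonoidAlgebra.of R _ (fσ d i))) = _
  unfold Y.lift
  refine (RingQuot.liftAlgHom_mkAlgHom_apply R _ _ _).trans ?_
  rw [MonoidAlgebra.lift_of, MonoidHom.comp_apply,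
    IsRep.groupHom, fσ, PresentedGroup.toGroup.of]
  rfl

theorem Y.lift_t {gg tt : ℕ → B} (H : IsRep d n ((q : R) - ((q⁻¹ : Rˣ) : R)) gg tt)
    (j : Fin n) : Y.lift H (t d q j) = tt j.1 := by
  change Y.lift H (RingQuot.mkAlgHom R (QuadRel R d n q) (MonoidAlgebra.of R _ (ft d j))) = _
  unfold Y.lift
  refine (RingQuot.liftAlgHom_mkAlgHom_apply R _ _ _).trans ?_
  rw [MonoidAlgebra.lift_of, MonoidHom.comp_apply,
    IsRep.groupHom, ft, PresentedGroup.toGroup.of]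
  rfl

theorem Y.lift_gT {gg tt : ℕ → B} (H : IsRep d n ((q : R) - ((q⁻¹ : Rˣ) : R)) gg tt)
    (i : ℕ) (h : i + 1 < n) : Y.lift H (gT d n q i) = gg i := by
  rw [gT_eq i h, Y.lift_g]

theorem Y.lift_tT {gg tt : ℕ → B} (H : IsRep d n ((q : R) - ((q⁻¹ : Rˣ) : R)) gg tt)
    (j : ℕ) (h : j < n) : Y.lift H (tT d n q j) = tt j := by
  rw [tT_eq j h, Y.lift_t]

theorem Y.hom_ext {f f' : Y R d n q →ₐ[R] B} (hg : ∀ i, i + 1 < n → f (gT d n q i) = f' (gT d n q i))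
    (ht : ∀ j, j < n → f (tT d n q j) = f' (tT d n q j)) : f = f' := by
  apply RingQuot.ringQuot_ext'
  apply MonoidAlgebra.algHom_ext'
  swap
  · ext
  have : ∀ F : Y R d n q →ₐ[R] B, (((F.comp (mkY R d n q)) :
      MonoidAlgebra R (FramedBraidGroup d n) →* B).comp (MonoidAlgebra.of R _)) =
      (F : Y R d n q →* B).comp (framedToY R d n q) := fun F => rfl
  change (((f.comp (mkY R d n q)) :
      MonoidAlgebra R (FramedBraidGroup d n) →* B).comp (MonoidAlgebra.of R _)) =
    (((f'.comp (mkY R d n q)) :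
      MonoidAlgebra R (FramedBraidGroup d n) →* B).comp (MonoidAlgebra.of R _))
  rw [this, this]
  have key : (f : Y R d n q →* B).comp (framedToY R d n q) =
      (f' : Y R d n q →* B).comp (framedToY R d n q) := by
    have : ((f : Y R d n q →* B).comp (framedToY R d n q)).toHomUnits =
        ((f' : Y R d n q →* B).comp (framedToY R d n q)).toHomUnits := by
      apply PresentedGroup.ext
      rintro (i | j)
      · ext
        have := hg i.1 i.2
        rw [gT_eq _ i.2] at this
        exact this
      · ext
        have := ht j.1 j.2
        rw [tT_eq _ j.2] at this
        exact this
    ext x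
    exact congrArg Units.val (DFunLike.congr_fun this x)
  exact key

theorem map_eB {B' : Type} [Ring B'] [Algebra R B'] (f : B →ₐ[R] B') (x y : B) :
    f (eB R d x y) = eB R d (f x) (f y) := by
  simp [eB]

theorem IsRep.of_injective {B' : Type} [Ring B'] [Algebra R B'] (f : B →ₐ[R] B')
    (hf : Function.Injective f) {v : R} {gg tt : ℕ → B}
    (H : IsRep d n v (fun i => f (gg i)) (fun j => f (tt j))) : IsRep d n v gg tt where
  braid i h := hf (by simpa using H.braid i h)
  far i j h h' := hf (by simpa using H.far i j h h')
  tt i j h h' := hf (by simpa using H.tt i j h h')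
  tg0 i h := hf (by simpa using H.tg0 i h)
  tg1 i h := hf (by simpa using H.tg1 i h)
  tg i j h h' h1 h2 := hf (by simpa using H.tg i j h h' h1 h2)
  td j h := hf (by simpa using H.td j h)
  quad i h := hf (by simpa [map_eB] using H.quad i h)

/-- Induction along the generators. -/
theorem Y.mem_of_gen (S : Subalgebra R (Y R d n q)) (hg : ∀ i, i + 1 < n → gT d n q i ∈ S)
    (ht : ∀ j, j < n → tT d n q j ∈ S) (y : Y R d n q) : y ∈ S := by
  have hg' : ∀ i, gT d n q i ∈ S := fun i => by
    by_cases h : i + 1 < n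
    · exact hg i h
    · rw [gT, dif_neg h]; exact S.zero_mem
  have ht' : ∀ i, tT d n q i ∈ S := fun i => by
    by_cases h : i < n
    · exact ht i h
    · rw [tT, dif_neg h]; exact S.zero_mem
  have H : IsRep (B := S) d n ((q : R) - ((q⁻¹ : Rˣ) : R)) (fun i => ⟨gT d n q i, hg' i⟩)
      (fun i => ⟨tT d n q i, ht' i⟩) :=
    IsRep.of_injective S.val Subtype.val_injective isRep_Y
  have : S.val.comp (Y.lift H) = AlgHom.id R _ :=
    Y.hom_ext (fun i h => by simp [Y.lift_gT H i h]) (fun j h => by simp [Y.lift_tT H j h])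
  have h2 := DFunLike.congr_fun this y
  simp only [AlgHom.comp_apply, AlgHom.id_apply] at h2
  rw [← h2]
  exact (Y.lift H y).2

/-! ### Identities between the generators -/

theorem chi_add (a b : ZMod d) : chi R (a + b) = chi R a * chi R b := by
  rw [chi, AddChar.map_add_eq_mul, map_mul]; rfl

theorem chi_zero : chi R (0 : ZMod d) = 1 := by
  rw [chi, AddChar.map_zero_eq_one, map_one]

theorem chi_nsmul (a : ZMod d) (s : ℕ) : chi R a ^ s = chi R ((s : ZMod d) * a) := by
  induction s with
  | zero => simp [chi_zero]
  | succ s ih => rw [pow_succ, ih, ← chi_add]; push_cast; ring_nf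

theorem sum_chi (a : ZMod d) :
    invd R d * ∑ s : ZMod d, chi R (s * a) = if a = 0 then 1 else 0 := by
  have h := AddChar.sum_mulShift a (ZMod.isPrimitive_stdAddChar d)
  simp only [chi, invd]
  rw [← map_sum, ← map_mul, h]
  have hd : (d : ℂ) ≠ 0 := Nat.cast_ne_zero.2 (NeZero.ne d)
  split_ifs
  · simp [ZMod.card, hd]
  · simp

/-- The projection onto the eigenspace of an element of order `d`. -/
def pB (R : Type) [CommRing R] [Algebra ℂ R] {B : Type} [Ring B] [Algebra R B]
    {d : ℕ} [NeZero d] (x : B) (a : ZMod d) : B :=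
  invd R d • ∑ s : ZMod d, chi R (-(s * a)) • x ^ s.val

theorem mul_pB {x : B} (hx : x ^ d = 1) (a : ZMod d) : x * pB R x a = chi R a • pB R x a := by
  rw [pB, mul_smul_comm, smul_comm (chi R a) (invd R d), Finset.mul_sum, Finset.smul_sum (r := chi R a)]
  congr 1
  refine Fintype.sum_equiv (Equiv.addRight (1 : ZMod d)) _ _ fun s => ?_
  have h1 : x = x ^ (1 : ZMod d).val := by
    have := pow_val_natCast hx 1
    rw [Nat.cast_one, pow_one] at this
    exact this.symm
  simp only [Equiv.coe_addRight]
  rw [pow_val_add hx, ← h1, smul_smul, ← chi_add, mul_smul_comm, ← pow_succ', ← pow_succ]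
  congr 2
  ring

theorem pow_mul_pB {x : B} (hx : x ^ d = 1) (a : ZMod d) (s : ℕ) :
    x ^ s * pB R x a = chi R ((s : ZMod d) * a) • pB R x a := by
  induction s with
  | zero => simp [chi_zero]
  | succ s ih =>
    rw [pow_succ, mul_assoc, mul_pB hx, mul_smul_comm, ih, smul_smul, ← chi_add]
    push_cast; ring_nf

theorem pow_val_mul_pB {x : B} (hx : x ^ d = 1) (a s : ZMod d) :
    x ^ s.val * pB R x a = chi R (s * a) • pB R x a := by
  rw [pow_mul_pB hx, ZMod.natCast_zmod_val]

theorem pB_idem {x : B} (hx : x ^ d = 1) (a : ZMod d) : pB R x a * pB R x a = pB R x a := by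
  have h : pB R x a * pB R x a =
      (invd R d * ∑ s : ZMod d, chi R (s * (0 : ZMod d))) • pB R x a := by
    conv_lhs => enter [1]; rw [pB]
    rw [smul_mul_assoc, Finset.sum_mul, mul_smul, Finset.sum_smul]
    congr 1
    refine Finset.sum_congr rfl fun s _ => ?_
    rw [smul_mul_assoc, pow_val_mul_pB hx, smul_smul, ← chi_add]
    congr 2
    ring
  rw [h, sum_chi, if_pos rfl, one_smul]

theorem sum_pB (x : B) : ∑ a : ZMod d, pB R x a = 1 := by
  simp only [pB]
  rw [← Finset.smul_sum, Finset.sum_comm]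
  have : ∀ s : ZMod d, invd R d • ∑ a : ZMod d, chi R (-(s * a)) • x ^ s.val =
      if s = 0 then 1 else 0 := fun s => by
    rw [← Finset.sum_smul, smul_smul]
    have h := sum_chi (R := R) (-s)
    have h2 : ∑ a : ZMod d, chi R (-(s * a)) = ∑ a : ZMod d, chi R (a * -s) :=
      Finset.sum_congr rfl fun a _ => by congr 1; ring
    rw [h2, h]
    by_cases hs : s = 0
    · simp [hs]
    · simp [hs]
  rw [Finset.smul_sum, Finset.sum_congr rfl fun s _ => this s]
  simp

theorem pB_semiconj {x y c : B} (h : SemiconjBy c x y) (a : ZMod d) :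
    SemiconjBy c (pB R x a) (pB R y a) := by
  simp only [SemiconjBy, pB]
  rw [mul_smul_comm, smul_mul_assoc, Finset.mul_sum, Finset.sum_mul]
  congr 1
  refine Finset.sum_congr rfl fun s _ => ?_
  rw [mul_smul_comm, smul_mul_assoc, (h.pow_right s.val).eq]

theorem pB_commute {x c : B} (h : Commute c x) (a : ZMod d) : Commute c (pB R x a) :=
  pB_semiconj h a

theorem eB_mul_pB_right {x y : B} (hy : y ^ d = 1)
    (a : ZMod d) : eB R d x y * pB R y a = pB R x a * pB R y a := by
  have h : pB R x a * pB R y a =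
      invd R d • ∑ s : ZMod d, (chi R (-(s * a)) • x ^ s.val) * pB R y a := by
    conv_lhs => enter [1]; rw [pB]
    rw [smul_mul_assoc, Finset.sum_mul]
  rw [h, eB, smul_mul_assoc, Finset.sum_mul]
  congr 1
  refine Finset.sum_congr rfl fun s _ => ?_
  rw [mul_assoc, pow_val_mul_pB hy, mul_smul_comm, smul_mul_assoc, neg_mul]

/-- The product `g_j g_{j+1} ⋯ g_{j+l-1}`. -/
def W (gg : ℕ → B) (j : ℕ) : ℕ → B
  | 0 => 1
  | l + 1 => W gg j l * gg (j + l)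

namespace IsRep

variable {v : R} {gg tt : ℕ → B}

theorem g_p0 (H : IsRep d n v gg tt) (i : ℕ) (h : i + 1 < n) (a : ZMod d) :
    gg i * pB R (tt (i + 1)) a = pB R (tt i) a * gg i :=
  (pB_semiconj (show SemiconjBy (gg i) (tt (i + 1)) (tt i) from (H.tg0 i h).symm) a).eq

theorem g_p1 (H : IsRep d n v gg tt) (i : ℕ) (h : i + 1 < n) (a : ZMod d) :
    gg i * pB R (tt i) a = pB R (tt (i + 1)) a * gg i :=
  (pB_semiconj (show SemiconjBy (gg i) (tt i) (tt (i + 1)) from (H.tg1 i h).symm) a).eq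

theorem g_p (H : IsRep d n v gg tt) (i j : ℕ) (h : i + 1 < n) (hj : j < n) (h1 : j ≠ i) (h2 : j ≠ i + 1) (a : ZMod d) :
    gg i * pB R (tt j) a = pB R (tt j) a * gg i :=
  (pB_commute (show Commute (gg i) (tt j) from (H.tg i j h hj h1 h2).symm) a).eq

theorem t_p (H : IsRep d n v gg tt) (i j : ℕ) (h : i < n) (hj : j < n) (a : ZMod d) :
    tt i * pB R (tt j) a = pB R (tt j) a * tt i :=
  (pB_commute (show Commute (tt i) (tt j) from H.tt i j h hj) a).eq

end IsRep

theorem W_succ' (gg : ℕ → B) (j l : ℕ) : W gg j (l + 1) = gg j * W gg (j + 1) l := by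
  induction l with
  | zero => simp [W]
  | succ l ih => rw [W, ih, W, mul_assoc]; congr 3; ring

theorem W_commute {gg : ℕ → B} {x : B} {j l : ℕ} (h : ∀ k, j ≤ k → k < j + l → Commute x (gg k)) :
    Commute x (W gg j l) := by
  induction l with
  | zero => exact Commute.one_right _
  | succ l ih =>
    exact (ih fun k h1 h2 => h k h1 (by omega)).mul_right (h _ (by omega) (by omega))

/-- The products `p_{j,a} g_j ⋯ g_{n-1}`. -/
def P (R : Type) [CommRing R] [Algebra ℂ R] {B : Type} [Ring B] [Algebra R B]
    {d : ℕ} [NeZero d] (gg tt : ℕ → B) (n j : ℕ) (a : ZMod d) : B :=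
  pB R (tt j) a * W gg j (n - j)

namespace IsRep

variable {v : R} {gg tt : ℕ → B}

theorem W_t_low (H : IsRep d (n + 1) v gg tt) {i j l : ℕ} (h : i < j) (hn : j + l ≤ n) : Commute (tt i) (W gg j l) :=
  W_commute fun k h1 h2 => H.tg k i (by omega) (by omega) (by omega) (by omega)

theorem W_t_high (H : IsRep d (n + 1) v gg tt) {i j l : ℕ} (h : j + l < i) (hn : i ≤ n) : Commute (tt i) (W gg j l) :=
  W_commute fun k h1 h2 => H.tg k i (by omega) (by omega) (by omega) (by omega)

theorem W_t_mid (H : IsRep d (n + 1) v gg tt) {i j l : ℕ} (h : j < i) (h' : i ≤ j + l) (hn : j + l ≤ n) :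
    tt i * W gg j l = W gg j l * tt (i - 1) := by
  induction l with
  | zero => omega
  | succ l ih =>
    rw [W]
    by_cases hi : i ≤ j + l
    · rw [← mul_assoc, ih hi (by omega), mul_assoc, mul_assoc,
        H.tg (j + l) (i - 1) (by omega) (by omega) (by omega) (by omega)]
    · have : i = j + l + 1 := by omega
      subst this
      rw [← mul_assoc, (H.W_t_high (by omega) (by omega)).eq, mul_assoc, mul_assoc,
        H.tg1 (j + l) (by omega)]
      rfl

theorem W_g_low (H : IsRep d (n + 1) v gg tt) {i j l : ℕ} (h : i + 1 < j) (hn : j + l ≤ n) : Commute (gg i) (W gg j l) :=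
  W_commute fun k h1 h2 => H.far i k (by omega) (by omega)

theorem W_g_high (H : IsRep d (n + 1) v gg tt) {i j l : ℕ} (h : j + l < i) (hn : i < n) : Commute (gg i) (W gg j l) :=
  W_commute fun k h1 h2 => (H.far k i (by omega) (by omega)).symm

theorem W_g_mid (H : IsRep d (n + 1) v gg tt) {i j l : ℕ} (h : j < i) (h' : i < j + l) (hn : j + l ≤ n) :
    gg i * W gg j l = W gg j l * gg (i - 1) := by
  induction l with
  | zero => omega
  | succ l ih =>
    rw [W]
    by_cases hi : i < j + l
    · rw [← mul_assoc, ih hi (by omega), mul_assoc, mul_assoc,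
        H.far (i - 1) (j + l) (by omega) (by omega)]
    · have : i = j + l := by omega
      subst this
      obtain ⟨l, rfl⟩ : ∃ m, l = m + 1 := ⟨l - 1, by omega⟩
      rw [W, show j + (l + 1) - 1 = j + l by omega, ← mul_assoc, ← mul_assoc,
        (H.W_g_high (by omega) (by omega)).eq, mul_assoc, mul_assoc, mul_assoc, mul_assoc]
      congr 1
      have := H.braid (j + l) (by omega)
      rw [← mul_assoc, ← mul_assoc, ← add_assoc, this]

theorem g_P_high (H : IsRep d (n + 1) v gg tt) (i j : ℕ) (h : j < i) (hi : i < n) (a : ZMod d) :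
    gg i * P R gg tt n j a = P R gg tt n j a * gg (i - 1) := by
  rw [P, ← mul_assoc, H.g_p i j (by omega) (by omega) (by omega) (by omega), mul_assoc,
    H.W_g_mid h (by omega) (by omega), mul_assoc]

theorem g_P_succ (H : IsRep d (n + 1) v gg tt) (i : ℕ) (hi : i < n) (a : ZMod d) :
    gg i * P R gg tt n (i + 1) a = P R gg tt n i a := by
  rw [P, P, ← mul_assoc, H.g_p0 i (by omega), mul_assoc, ← W_succ']
  congr 2; omega

theorem g_P_low (H : IsRep d (n + 1) v gg tt) (i j : ℕ) (h : i + 1 < j) (hj : j ≤ n) (a : ZMod d) :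
    gg i * P R gg tt n j a = P R gg tt n j a * gg i := by
  rw [P, ← mul_assoc, H.g_p i j (by omega) (by omega) (by omega) (by omega), mul_assoc,
    (H.W_g_low h (by omega)).eq, mul_assoc]

theorem t_P_eq (H : IsRep d (n + 1) v gg tt) (i : ℕ) (hi : i ≤ n) (a : ZMod d) :
    tt i * P R gg tt n i a = chi R a • P R gg tt n i a := by
  rw [P, ← mul_assoc, mul_pB (H.td i (by omega)), smul_mul_assoc]

theorem t_P_low (H : IsRep d (n + 1) v gg tt) (i j : ℕ) (h : i < j) (hj : j ≤ n) (a : ZMod d) :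
    tt i * P R gg tt n j a = P R gg tt n j a * tt i := by
  rw [P, ← mul_assoc, H.t_p i j (by omega) (by omega), mul_assoc,
    (H.W_t_low h (by omega)).eq, mul_assoc]

theorem t_P_high (H : IsRep d (n + 1) v gg tt) (i j : ℕ) (h : j < i) (hi : i ≤ n) (a : ZMod d) :
    tt i * P R gg tt n j a = P R gg tt n j a * tt (i - 1) := by
  rw [P, ← mul_assoc, H.t_p i j (by omega) (by omega), mul_assoc,
    H.W_t_mid h (by omega) (by omega), mul_assoc]

theorem g_P_eq (H : IsRep d (n + 1) v gg tt) (i : ℕ) (hi : i < n) (a : ZMod d) :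
    gg i * P R gg tt n i a =
      P R gg tt n (i + 1) a + v • (P R gg tt n i a * pB R (tt i) a) := by
  have hc : Commute (pB R (tt i) a) (W gg (i + 1) (n - (i + 1))) :=
    (pB_commute (H.W_t_low (i := i) (by omega) (by omega)).symm a).symm
  have hW : W gg i (n - i) = gg i * W gg (i + 1) (n - (i + 1)) := by
    rw [← W_succ']; congr 1; omega
  have h1 : gg i * P R gg tt n i a =
      pB R (tt (i + 1)) a * (gg i * gg i) * W gg (i + 1) (n - (i + 1)) := by
    rw [P, hW, ← mul_assoc, H.g_p1 i (by omega)]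
    simp only [mul_assoc]
  have h2 : P R gg tt n i a * pB R (tt i) a =
      pB R (tt (i + 1)) a * eB R d (tt i) (tt (i + 1)) * gg i * W gg (i + 1) (n - (i + 1)) := by
    have hcomm : Commute (tt i) (tt (i + 1)) := H.tt i (i + 1) (by omega) (by omega)
    have h3 : pB R (tt (i + 1)) a * eB R d (tt i) (tt (i + 1)) =
        eB R d (tt i) (tt (i + 1)) * pB R (tt (i + 1)) a := by
      rw [eB, smul_mul_assoc, mul_smul_comm, Finset.mul_sum, Finset.sum_mul]
      congr 1
      refine Finset.sum_congr rfl fun s _ => ?_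
      refine Commute.eq (Commute.mul_right ?_ ?_)
      · exact (pB_commute (hcomm.pow_left _) a).symm
      · exact (pB_commute ((Commute.refl _).pow_left _) a).symm
    rw [h3, eB_mul_pB_right (H.td _ (by omega)), mul_assoc (pB R (tt i) a), ← H.g_p1 i (by omega),
      P, hW]
    simp only [mul_assoc]
    rw [hc.eq]
  rw [h1, h2, H.quad i (by omega), P, mul_add, mul_one, add_mul]
  simp only [mul_smul_comm, smul_mul_assoc, mul_assoc]

end IsRep

/-! ### The action of the next algebra -/

/-- The free module on symbols standing for `p_{j,a} g_j ⋯ g_{n-1}`. -/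
abbrev Mod (d n : ℕ) (B : Type) [Ring B] : Type := (Fin (n + 1) × ZMod d) →₀ B

/-- The basis vectors, with a coefficient. -/
def vec (n : ℕ) (j : ℕ) (a : ZMod d) (c : B) : Mod d n B := Finsupp.single (Fin.ofNat (n + 1) j, a) c

theorem vec_add (j : ℕ) (a : ZMod d) (c c' : B) :
    vec n j a (c + c') = vec n j a c + vec n j a c' := Finsupp.single_add _ _ _

theorem vec_smul (j : ℕ) (a : ZMod d) (r : R) (c : B) :
    vec n j a (r • c) = r • vec n j a c := (Finsupp.smul_single _ _ _).symm

theorem Mod.hom_ext {N : Type} [AddCommGroup N] [Module R N] {f f' : Mod d n B →ₗ[R] N}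
    (h : ∀ j ≤ n, ∀ a c, f (vec n j a c) = f' (vec n j a c)) : f = f' := by
  apply Finsupp.lhom_ext
  rintro ⟨j, a⟩ c
  have := h j.1 (by omega) a c
  simpa [vec] using this

/-- The left action of `g_i`. -/
def opG (n : ℕ) (v : R) (gg tt : ℕ → B) (i : ℕ) : Module.End R (Mod d n B) :=
  Finsupp.lsum R fun p =>
    if p.1.1 < i then (Finsupp.lsingle p).comp (LinearMap.mulLeft R (gg (i - 1)))
    else if p.1.1 = i then Finsupp.lsingle (Fin.ofNat (n + 1) (i + 1), p.2) +
      v • (Finsupp.lsingle p).comp (LinearMap.mulLeft R (pB R (tt i) p.2))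
    else if p.1.1 = i + 1 then Finsupp.lsingle (Fin.ofNat (n + 1) i, p.2)
    else (Finsupp.lsingle p).comp (LinearMap.mulLeft R (gg i))

/-- The left action of diagonal operators. -/
def opD (R : Type) [CommRing R] {B : Type} [Ring B] [Algebra R B] {d : ℕ}
    (n : ℕ) (u : ℕ → ZMod d → B) : Module.End R (Mod d n B) :=
  Finsupp.lsum R fun p => (Finsupp.lsingle p).comp (LinearMap.mulLeft R (u p.1.1 p.2))

/-- The diagonal coefficients of `t_i`. -/
def uT (R : Type) [CommRing R] [Algebra ℂ R] {B : Type} [Ring B] [Algebra R B]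
    {d : ℕ} [NeZero d] (tt : ℕ → B) (i j : ℕ) (a : ZMod d) : B :=
  if j = i then chi R a • 1 else if i < j then tt i else tt (i - 1)

theorem opD_vec (u : ℕ → ZMod d → B) (j : ℕ) (hj : j ≤ n) (a : ZMod d) (c : B) :
    opD R n u (vec n j a c) = vec n j a (u j a * c) := by
  simp [opD, vec, Nat.mod_eq_of_lt (show j < n + 1 by omega)]

section
variable {v : R} {gg tt : ℕ → B}

theorem opG_high {i j : ℕ} (h : j < i) (hj : j ≤ n) (a : ZMod d) (c : B) :
    opG n v gg tt i (vec n j a c) = vec n j a (gg (i - 1) * c) := by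
  simp [opG, vec, Nat.mod_eq_of_lt (show j < n + 1 by omega), h]

theorem opG_eq {i : ℕ} (hj : i ≤ n) (a : ZMod d) (c : B) :
    opG n v gg tt i (vec n i a c) =
      vec n (i + 1) a c + v • vec n i a (pB R (tt i) a * c) := by
  simp [opG, vec, Nat.mod_eq_of_lt (show i < n + 1 by omega)]

theorem opG_succ {i : ℕ} (hj : i + 1 ≤ n) (a : ZMod d) (c : B) :
    opG n v gg tt i (vec n (i + 1) a c) = vec n i a c := by
  simp [opG, vec, Nat.mod_eq_of_lt (show i + 1 < n + 1 by omega)]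

theorem opG_low {i j : ℕ} (h : i + 1 < j) (hj : j ≤ n) (a : ZMod d) (c : B) :
    opG n v gg tt i (vec n j a c) = vec n j a (gg i * c) := by
  simp [opG, vec, Nat.mod_eq_of_lt (show j < n + 1 by omega), show ¬ j < i by omega,
    show ¬ j = i by omega, show ¬ j = i + 1 by omega]

theorem opD_one : opD R n (fun (_ : ℕ) (_ : ZMod d) => (1 : B)) = 1 :=
  Mod.hom_ext fun j hj a c => by simp [opD_vec _ j hj]

theorem opD_mul (u u' : ℕ → ZMod d → B) :
    opD R n u * opD R n u' = opD R n (fun j a => u j a * u' j a) :=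
  Mod.hom_ext fun j hj a c => by
    rw [Module.End.mul_apply, opD_vec _ j hj, opD_vec _ j hj, opD_vec _ j hj, mul_assoc]

theorem opD_pow (u : ℕ → ZMod d → B) (s : ℕ) :
    opD R n u ^ s = opD R n (fun j a => u j a ^ s) := by
  induction s with
  | zero => simpa using opD_one.symm
  | succ s ih => simp only [pow_succ, ih, opD_mul]

theorem eB_opD (u u' : ℕ → ZMod d → B) :
    eB R d (opD R n u) (opD R n u') = opD R n (fun j a => eB R d (u j a) (u' j a)) :=
  Mod.hom_ext fun j hj a c => by
    rw [opD_vec _ j hj, eB, eB, LinearMap.smul_apply, LinearMap.sum_apply]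
    have : ∀ s : ZMod d, (opD R n u ^ s.val * opD R n u' ^ (-s).val) (vec n j a c) =
        vec n j a (u j a ^ s.val * u' j a ^ (-s).val * c) := fun s => by
      rw [opD_pow, opD_pow, opD_mul, opD_vec _ j hj]
    simp only [this]
    rw [smul_mul_assoc, vec_smul, Finset.sum_mul]
    congr 1
    exact (Finsupp.single_finsetSum _ _ _).symm

theorem eB_chi_left {y : B} (a : ZMod d) : eB R d (chi R a • 1) y = pB R y a := by
  rw [eB, pB]
  congr 1
  refine Fintype.sum_equiv (Equiv.neg _) _ _ fun s => ?_
  simp only [Equiv.neg_apply, smul_pow, one_pow, smul_mul_assoc, one_mul, chi_nsmul,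
    ZMod.natCast_zmod_val, neg_mul, neg_neg]

theorem eB_chi_right {x : B} (a : ZMod d) : eB R d x (chi R a • 1) = pB R x a := by
  rw [eB, pB]
  congr 1
  refine Finset.sum_congr rfl fun s _ => ?_
  simp only [smul_pow, one_pow, mul_smul_comm, mul_one, chi_nsmul,
    ZMod.natCast_zmod_val, neg_mul]

theorem chi_pow_d (a : ZMod d) : chi R a ^ d = 1 := by
  rw [chi_nsmul]; simp [chi_zero]

theorem IsRep.mod (H : IsRep d n v gg tt) :
    IsRep d (n + 1) v (opG (d := d) n v gg tt) (fun i => opD R n (uT (d := d) R tt i)) where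
  braid i h := Mod.hom_ext fun j hj a c => by
    simp only [Module.End.mul_apply]
    rcases lt_trichotomy j i with h1 | h1 | h1
    · simp only [opG_high h1 hj, opG_high (show j < i + 1 by omega) hj, ← mul_assoc]
      have := H.braid (i - 1) (by omega)
      rw [show i - 1 + 1 = i by omega] at this
      simp only [Nat.add_sub_cancel, this]
    · subst h1
      simp only [opG_eq hj, opG_high (show j < j + 1 by omega) hj, opG_eq (show j + 1 ≤ n by omega),
        opG_low (show j + 1 < j + 1 + 1 by omega) (show j + 1 + 1 ≤ n by omega),
        opG_succ (show j + 1 ≤ n by omega), map_add, map_smul, Nat.add_sub_cancel]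
      have e1 := H.g_p1 j (by omega) a
      have e2 : gg j * (pB R (tt j) a * (gg j * c)) =
          pB R (tt (j + 1)) a * c +
            v • (pB R (tt j) a * (gg j * (pB R (tt j) a * c))) := by
        rw [← mul_assoc, e1, mul_assoc, ← mul_assoc (gg j), H.quad j (by omega), add_mul, mul_add,
          one_mul, smul_mul_assoc, mul_smul_comm]
        congr 2
        have hcomm : Commute (tt j) (tt (j + 1)) := H.tt j (j + 1) (by omega) (by omega)
        have h3 : pB R (tt (j + 1)) a * eB R d (tt j) (tt (j + 1)) =
            eB R d (tt j) (tt (j + 1)) * pB R (tt (j + 1)) a := by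
          rw [eB, smul_mul_assoc, mul_smul_comm, Finset.mul_sum, Finset.sum_mul]
          congr 1
          refine Finset.sum_congr rfl fun s _ => ?_
          refine Commute.eq (Commute.mul_right ?_ ?_)
          · exact (pB_commute (hcomm.pow_left _) a).symm
          · exact (pB_commute ((Commute.refl _).pow_left _) a).symm
        rw [← mul_assoc, ← mul_assoc, h3, eB_mul_pB_right (H.td _ (by omega)), mul_assoc _ _ (gg j),
          ← e1]
        simp only [mul_assoc]
      have e3 : gg j * (pB R (tt j) a * c) = pB R (tt (j + 1)) a * (gg j * c) := by
        rw [← mul_assoc, e1, mul_assoc]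
      rw [e2, vec_add, vec_smul, e3]
      simp only [smul_add]
      abel
    · by_cases h2 : j = i + 1
      · subst h2
        simp only [opG_eq hj, opG_eq (show i ≤ n by omega), opG_succ hj,
          opG_high (show i < i + 1 by omega) (show i ≤ n by omega), map_add, map_smul,
          opG_low (show i + 1 < i + 1 + 1 by omega) (show i + 1 + 1 ≤ n by omega),
          opG_succ (show i + 1 + 1 ≤ n by omega), Nat.add_sub_cancel]
        rw [← mul_assoc, ← mul_assoc, H.g_p0 i (by omega)]
      · by_cases h3 : j = i + 1 + 1
        · subst h3
          simp only [opG_low (show i + 1 < i + 1 + 1 by omega) hj, opG_succ hj,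
            opG_succ (show i + 1 ≤ n by omega),
            opG_high (show i < i + 1 by omega) (show i ≤ n by omega), Nat.add_sub_cancel]
        · simp only [opG_low (show i + 1 < j by omega) hj,
            opG_low (show i + 1 + 1 < j by omega) hj, ← mul_assoc]
          rw [H.braid i (by omega)]
  far i k hik hk := Mod.hom_ext fun j hj a c => by
    simp only [Module.End.mul_apply]
    have hlow : ∀ x, i + 1 < x → x ≤ n → ∀ a c,
      opG (d := d) n v gg tt i (vec n x a c) = vec n x a (gg i * c) := fun x hx hx' a c =>
        opG_low hx hx' a c
    have hhigh : ∀ x, x < k → ∀ a c,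
      opG (d := d) n v gg tt k (vec n x a c) = vec n x a (gg (k - 1) * c) := fun x hx a c =>
        opG_high hx (by omega) a c
    rcases lt_trichotomy j i with h1 | h1 | h1
    · simp only [opG_high h1 hj, hhigh j (by omega), ← mul_assoc]
      rw [H.far (i - 1) (k - 1) (by omega) (by omega)]
    · subst h1
      rw [hhigh j (by omega), opG_eq hj, opG_eq hj, map_add, map_smul, hhigh (j + 1) hik,
        hhigh j (by omega), ← mul_assoc, ← mul_assoc, H.g_p (k - 1) j (by omega) (by omega)
          (by omega) (by omega)]
    · by_cases h2 : j = i + 1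
      · subst h2
        rw [hhigh _ (by omega), opG_succ hj, opG_succ hj, hhigh _ (by omega)]
      have h3 : i + 1 < j := by omega
      rw [hlow j h3 hj]
      rcases lt_trichotomy j k with h4 | h4 | h4
      · rw [hhigh j h4, hhigh j h4, hlow j h3 hj, ← mul_assoc, ← mul_assoc,
          H.far i (k - 1) (by omega) (by omega)]
      · subst h4
        rw [opG_eq hj, opG_eq hj, map_add, map_smul, hlow _ (by omega) (by omega), hlow _ h3 hj,
          ← mul_assoc, ← mul_assoc, H.g_p i j (by omega) (by omega) (by omega) (by omega)]
      · by_cases h5 : j = k + 1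
        · subst h5
          rw [opG_succ hj, opG_succ hj, hlow k hik (by omega)]
        · rw [opG_low (show k + 1 < j by omega) hj, opG_low (show k + 1 < j by omega) hj,
            hlow j h3 hj, ← mul_assoc, ← mul_assoc, H.far i k hik (by omega)]
  tt i k hi hk := Mod.hom_ext fun j hj a c => by
    rw [opD_mul, opD_mul, opD_vec _ j hj, opD_vec _ j hj]
    congr 2
    simp only [uT]
    split_ifs <;> first
      | exact H.tt _ _ (by omega) (by omega)
      | simp
  tg0 i h := Mod.hom_ext fun j hj a c => by
    simp only [Module.End.mul_apply, opD_vec _ j hj]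
    rcases lt_trichotomy j i with h1 | h1 | h1
    · simp only [opG_high h1 hj, opD_vec _ j hj, uT, if_neg (show ¬ j = i by omega),
        if_neg (show ¬ i < j by omega), if_neg (show ¬ j = i + 1 by omega),
        if_neg (show ¬ i + 1 < j by omega), ← mul_assoc]
      have := H.tg0 (i - 1) (by omega)
      rw [show i - 1 + 1 = i by omega] at this
      rw [this]; rfl
    · subst h1
      simp only [opG_eq hj, map_add, map_smul, opD_vec _ j hj, opD_vec _ (j + 1) (by omega : j + 1 ≤ n),
        uT, if_true, if_neg (show ¬ j + 1 = j by omega), if_pos (show j < j + 1 by omega),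
        if_neg (show ¬ j = j + 1 by omega), if_neg (show ¬ j + 1 < j by omega)]
      rw [smul_mul_assoc, one_mul, Nat.add_sub_cancel, ← mul_assoc (pB R (tt j) a),
        ← H.t_p j j (by omega) (by omega), mul_pB (H.td _ (by omega)), smul_mul_assoc]
    · by_cases h2 : j = i + 1
      · subst h2
        simp only [opG_succ hj, opD_vec _ i (by omega : i ≤ n), uT, if_true]
      · simp only [opG_low (show i + 1 < j by omega) hj, opD_vec _ j hj, uT,
          if_neg (show ¬ j = i by omega), if_pos (show i < j by omega), if_neg h2,
          if_pos (show i + 1 < j by omega), ← mul_assoc]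
        rw [H.tg0 i (by omega)]
  tg1 i h := Mod.hom_ext fun j hj a c => by
    simp only [Module.End.mul_apply, opD_vec _ j hj]
    rcases lt_trichotomy j i with h1 | h1 | h1
    · simp only [opG_high h1 hj, opD_vec _ j hj, uT, if_neg (show ¬ j = i by omega),
        if_neg (show ¬ i < j by omega), if_neg (show ¬ j = i + 1 by omega),
        if_neg (show ¬ i + 1 < j by omega), ← mul_assoc]
      have := H.tg1 (i - 1) (by omega)
      rw [show i - 1 + 1 = i by omega] at this
      rw [← this]; rfl
    · subst h1
      simp only [opG_eq hj, map_add, map_smul, opD_vec _ j hj, opD_vec _ (j + 1) (by omega : j + 1 ≤ n),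
        uT, if_true, if_neg (show ¬ j = j + 1 by omega), if_neg (show ¬ j + 1 < j by omega)]
      rw [smul_mul_assoc, one_mul, Nat.add_sub_cancel, ← mul_assoc (tt j), 
        mul_pB (H.td _ (by omega)), mul_smul_comm, smul_mul_assoc]
    · by_cases h2 : j = i + 1
      · subst h2
        simp only [opG_succ hj, opD_vec _ i (by omega : i ≤ n), uT,
          if_neg (show ¬ i + 1 = i by omega), if_pos (show i < i + 1 by omega),
          if_neg (show ¬ i = i + 1 by omega), if_neg (show ¬ i + 1 < i by omega),
          Nat.add_sub_cancel]
      · simp only [opG_low (show i + 1 < j by omega) hj, opD_vec _ j hj, uT,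
          if_neg (show ¬ j = i by omega), if_pos (show i < j by omega), if_neg h2,
          if_pos (show i + 1 < j by omega), ← mul_assoc]
        rw [H.tg1 i (by omega)]
  tg i k h hk h1 h2 := Mod.hom_ext fun j hj a c => by
    simp only [Module.End.mul_apply, opD_vec _ j hj]
    rcases lt_trichotomy j i with h3 | h3 | h3
    · simp only [opG_high h3 hj, opD_vec _ j hj, ← mul_assoc]
      congr 2
      simp only [uT]
      split_ifs
      · simp
      · exact H.tg _ _ (by omega) (by omega) (by omega) (by omega)
      · exact H.tg _ _ (by omega) (by omega) (by omega) (by omega)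
    · subst h3
      have hu : uT R tt k (j + 1) a = uT R tt k j a := by
        simp only [uT]
        split_ifs <;> first | omega | rfl
      simp only [opG_eq hj, map_add, map_smul, opD_vec _ j hj,
        opD_vec _ (j + 1) (by omega : j + 1 ≤ n), hu, ← mul_assoc]
      have : uT R tt k j a * pB R (tt j) a = pB R (tt j) a * uT R tt k j a := by
        simp only [uT]
        split_ifs
        · simp
        · exact H.t_p _ _ (by omega) (by omega) _
        · exact H.t_p _ _ (by omega) (by omega) _
      rw [this]
    · by_cases h4 : j = i + 1
      · subst h4
        have hu : uT R tt k (i + 1) a = uT R tt k i a := by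
          simp only [uT]
          split_ifs <;> first | omega | rfl
        simp only [opG_succ hj, opD_vec _ i (by omega : i ≤ n), hu]
      · simp only [opG_low (show i + 1 < j by omega) hj, opD_vec _ j hj, ← mul_assoc]
        congr 2
        simp only [uT]
        split_ifs
        · simp
        · exact H.tg _ _ (by omega) (by omega) (by omega) (by omega)
        · exact H.tg _ _ (by omega) (by omega) (by omega) (by omega)
  td i hi := Mod.hom_ext fun j hj a c => by
    rw [opD_pow, opD_vec _ j hj]
    have : uT R tt i j a ^ d = 1 := by
      simp only [uT]
      split_ifs
      · rw [smul_pow, chi_pow_d, one_pow, one_smul]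
      · exact H.td _ (by omega)
      · exact H.td _ (by omega)
    rw [this, one_mul, Module.End.one_apply]
  quad i h := Mod.hom_ext fun j hj a c => by
    rw [eB_opD]
    simp only [Module.End.mul_apply, LinearMap.add_apply, LinearMap.smul_apply,
      Module.End.one_apply]
    rcases lt_trichotomy j i with h1 | h1 | h1
    · simp only [opG_high h1 hj, opD_vec _ j hj, ← mul_assoc]
      have := H.quad (i - 1) (by omega)
      rw [show i - 1 + 1 = i by omega] at this
      rw [this, add_mul, one_mul, vec_add, smul_mul_assoc, vec_smul]
      congr 3
      simp only [uT, if_neg (show ¬ j = i by omega), if_neg (show ¬ i < j by omega),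
        if_neg (show ¬ j = i + 1 by omega), if_neg (show ¬ i + 1 < j by omega), Nat.add_sub_cancel]
    · subst h1
      have u1 : eB R d (uT R tt j j a) (uT R tt (j + 1) j a) = pB R (tt j) a := by
        simp only [uT, if_true, if_neg (show ¬ j = j + 1 by omega),
          if_neg (show ¬ j + 1 < j by omega), Nat.add_sub_cancel, eB_chi_left]
      have u2 : eB R d (uT R tt j (j + 1) a) (uT R tt (j + 1) (j + 1) a) = pB R (tt j) a := by
        simp only [uT, if_true, if_neg (show ¬ j + 1 = j by omega),
          if_pos (show j < j + 1 by omega), eB_chi_right]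
      simp only [opG_eq hj, map_add, map_smul, opG_succ (show j + 1 ≤ n by omega),
        opD_vec _ j hj, opD_vec _ (j + 1) (by omega : j + 1 ≤ n), u1, u2]
    · by_cases h2 : j = i + 1
      · subst h2
        have u1 : eB R d (uT R tt i i a) (uT R tt (i + 1) i a) = pB R (tt i) a := by
          simp only [uT, if_true, if_neg (show ¬ i = i + 1 by omega),
            if_neg (show ¬ i + 1 < i by omega), Nat.add_sub_cancel, eB_chi_left]
        simp only [opG_succ hj, opG_eq (show i ≤ n by omega), opD_vec _ i (by omega : i ≤ n), u1]
      · simp only [opG_low (show i + 1 < j by omega) hj, opD_vec _ j hj, ← mul_assoc]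
        rw [H.quad i (by omega), add_mul, one_mul, vec_add, smul_mul_assoc, vec_smul]
        simp only [uT, if_neg (show ¬ j = i by omega), if_pos (show i < j by omega), if_neg h2,
          if_pos (show i + 1 < j by omega)]

end

/-! ### The inclusions `Y_{d,n} → Y_{d,n+1}` -/

theorem IsRep.mono {v : R} {gg tt : ℕ → B} (H : IsRep d (n + 1) v gg tt) : IsRep d n v gg tt where
  braid i h := H.braid i (by omega)
  far i j h h' := H.far i j h (by omega)
  tt i j h h' := H.tt i j (by omega) (by omega)
  tg0 i h := H.tg0 i (by omega)
  tg1 i h := H.tg1 i (by omega)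
  tg i j h h' h1 h2 := H.tg i j (by omega) (by omega) h1 h2
  td j h := H.td j (by omega)
  quad i h := H.quad i (by omega)

/-- The natural homomorphism `Y_{d,n}(q) → Y_{d,n+1}(q)`, sending `g_i` to `g_i` and `t_j` to
`t_j`. -/
def incl (d n : ℕ) [NeZero d] (q : Rˣ) : Y R d n q →ₐ[R] Y R d (n + 1) q :=
  Y.lift (isRep_Y (n := n + 1)).mono

theorem incl_gT (i : ℕ) (h : i + 1 < n) : incl d n q (gT d n q i) = gT d (n + 1) q i :=
  Y.lift_gT _ _ h

theorem incl_tT (i : ℕ) (h : i < n) : incl d n q (tT d n q i) = tT d (n + 1) q i :=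
  Y.lift_tT _ _ h

/-! ### The conditional expectation -/

/-- The action of `Y_{d,n+1}(q)` on the free module. -/
def act (d n : ℕ) [NeZero d] (q : Rˣ) : Y R d (n + 1) q →ₐ[R] Module.End R (Mod d n (Y R d n q)) :=
  Y.lift (isRep_Y (n := n)).mod

/-- The cyclic vector. -/
def vac (d n : ℕ) [NeZero d] (B : Type) [Ring B] : Mod d n B := ∑ a : ZMod d, vec n n a 1

/-- The evaluation of the free module in `Y_{d,n+1}(q)`. -/
def ev (d n : ℕ) [NeZero d] (q : Rˣ) : Mod d n (Y R d n q) →ₗ[R] Y R d (n + 1) q :=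
  Finsupp.lsum R fun p => (LinearMap.mulLeft R
    (P R (gT d (n + 1) q) (tT d (n + 1) q) n p.1.1 p.2)).comp (incl d n q).toLinearMap

theorem ev_vec (j : ℕ) (hj : j ≤ n) (a : ZMod d) (c : Y R d n q) :
    ev d n q (vec n j a c) = P R (gT d (n + 1) q) (tT d (n + 1) q) n j a * incl d n q c := by
  simp [ev, vec, Nat.mod_eq_of_lt (show j < n + 1 by omega)]

theorem act_gT (i : ℕ) (h : i < n) : act d n q (gT d (n + 1) q i) =
    opG n ((q : R) - ((q⁻¹ : Rˣ) : R)) (gT d n q) (tT d n q) i :=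
  Y.lift_gT _ _ (by omega)

theorem act_tT (i : ℕ) (h : i ≤ n) : act d n q (tT d (n + 1) q i) =
    opD R n (uT R (tT d n q) i) :=
  Y.lift_tT _ _ (by omega)

theorem ev_act (y : Y R d (n + 1) q) : ∀ m, ev d n q (act d n q y m) = y * ev d n q m := by
  have H := isRep_Y (R := R) (d := d) (n := n + 1) (q := q)
  let S : Subalgebra R (Y R d (n + 1) q) :=
    { carrier := {y | ∀ m, ev d n q (act d n q y m) = y * ev d n q m}
      mul_mem' := fun {x y} hx hy m => by
        rw [map_mul, Module.End.mul_apply, hx, hy, mul_assoc]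
      add_mem' := fun {x y} hx hy m => by
        rw [map_add, LinearMap.add_apply, map_add, hx, hy, add_mul]
      algebraMap_mem' := fun r m => by
        rw [AlgHom.commutes, Module.algebraMap_end_apply, map_smul, Algebra.smul_def] }
  refine Y.mem_of_gen S (fun i hi => ?_) (fun i hi => ?_) y
  · suffices h : (ev d n q).comp (act d n q (gT d (n + 1) q i)) =
        (LinearMap.mulLeft R (gT d (n + 1) q i)).comp (ev d n q) from
      fun m => LinearMap.congr_fun h m
    refine Mod.hom_ext fun j hj a c => ?_
    rw [act_gT i (by omega)]
    simp only [LinearMap.comp_apply, LinearMap.mulLeft_apply]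
    rcases lt_trichotomy j i with h1 | h1 | h1
    · rw [opG_high h1 hj, ev_vec j hj, ev_vec j hj, map_mul, incl_gT _ (by omega), ← mul_assoc,
        ← mul_assoc, H.g_P_high i j h1 (by omega)]
    · subst h1
      have hp : incl d n q (pB R (tT d n q j) a) = pB R (tT d (n + 1) q j) a := by
        simp [pB, incl_tT j (show j < n by omega)]
      rw [opG_eq hj, map_add, map_smul, ev_vec j hj, ev_vec (j + 1) (by omega), ev_vec j hj,
        map_mul, hp, ← mul_assoc, ← mul_assoc, H.g_P_eq j (by omega), add_mul, smul_mul_assoc]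
    · by_cases h2 : j = i + 1
      · subst h2
        rw [opG_succ hj, ev_vec _ hj, ev_vec i (by omega), ← mul_assoc, H.g_P_succ i (by omega)]
      · rw [opG_low (by omega) hj, ev_vec j hj, ev_vec j hj, map_mul, incl_gT _ (by omega),
          ← mul_assoc, ← mul_assoc, H.g_P_low i j (by omega) hj]
  · suffices h : (ev d n q).comp (act d n q (tT d (n + 1) q i)) =
        (LinearMap.mulLeft R (tT d (n + 1) q i)).comp (ev d n q) from
      fun m => LinearMap.congr_fun h m
    refine Mod.hom_ext fun j hj a c => ?_
    rw [act_tT i (by omega)]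
    simp only [LinearMap.comp_apply, LinearMap.mulLeft_apply, opD_vec _ j hj, uT]
    rcases lt_trichotomy j i with h1 | h1 | h1
    · rw [if_neg (by omega), if_neg (by omega), ev_vec j hj, ev_vec j hj, map_mul,
        incl_tT _ (by omega), ← mul_assoc, ← mul_assoc, H.t_P_high i j h1 (by omega)]
    · subst h1
      rw [if_pos rfl, smul_mul_assoc, one_mul, vec_smul, map_smul, ev_vec j hj, ← mul_assoc,
        H.t_P_eq j hj, smul_mul_assoc]
    · rw [if_neg (by omega), if_pos h1, ev_vec j hj, ev_vec j hj, map_mul,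
        incl_tT _ (by omega), ← mul_assoc, ← mul_assoc, H.t_P_low i j h1 hj]

theorem ev_vac : ev d n q (vac d n (Y R d n q)) = (1 : Y R d (n + 1) q) := by
  have : ∀ a : ZMod d, ev d n q (vec n n a 1) = pB R (tT d (n + 1) q n) a := fun a => by
    rw [ev_vec n le_rfl, P, Nat.sub_self, W, map_one, mul_one, mul_one]
  rw [vac, map_sum, Finset.sum_congr rfl fun a _ => this a, sum_pB]

/-- The inductive spanning set of `Y_{d,n+1}(q)`. -/
theorem span_induction {C : Y R d (n + 1) q → Prop} (hadd : ∀ x y, C x → C y → C (x + y))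
    (h0 : C 0)
    (ht : ∀ (a : ZMod d) (c : Y R d n q), C (pB R (tT d (n + 1) q n) a * incl d n q c))
    (hg : 1 ≤ n → ∀ b c : Y R d n q, C (incl d n q b * gT d (n + 1) q (n - 1) * incl d n q c))
    (y : Y R d (n + 1) q) : C y := by
  have key : ∀ m, C (ev d n q m) := fun m => by
    induction m using Finsupp.induction_linear with
    | zero => rw [map_zero]; exact h0
    | add x y hx hy => rw [map_add]; exact hadd _ _ hx hy
    | single p c =>
      obtain ⟨j, a⟩ := p
      have : (Finsupp.single (j, a) c : Mod d n (Y R d n q)) = vec n j.1 a c := by simp [vec]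
      rw [this, ev_vec _ (by omega)]
      rcases Nat.lt_or_ge j.1 n with hj | hj
      · obtain ⟨k, rfl⟩ : ∃ k, n = k + 1 := ⟨n - 1, by omega⟩
        have h2 := hg (by omega) (P R (gT d (k + 1) q) (tT d (k + 1) q) k j.1 a) c
        have hW : ∀ l, j.1 + l ≤ k → incl d (k + 1) q (W (gT d (k + 1) q) j.1 l) =
            W (gT d (k + 1 + 1) q) j.1 l := fun l => by
          induction l with
          | zero => intro _; simp [W]
          | succ l ih =>
            intro h
            rw [W, W, map_mul, ih (by omega), incl_gT _ (by omega)]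
        have hp : incl d (k + 1) q (pB R (tT d (k + 1) q j.1) a) = pB R (tT d (k + 1 + 1) q j.1) a := by
          simp [pB, incl_tT j.1 (show j.1 < k + 1 by omega)]
        have h3 : incl d (k + 1) q (P R (gT d (k + 1) q) (tT d (k + 1) q) k j.1 a) *
            gT d (k + 1 + 1) q (k + 1 - 1) =
            P R (gT d (k + 1 + 1) q) (tT d (k + 1 + 1) q) (k + 1) j.1 a := by
          rw [P, P, map_mul, hW _ (by omega), show k + 1 - j.1 = (k - j.1) + 1 by omega, W, hp,
            mul_assoc, show j.1 + (k - j.1) = k + 1 - 1 by omega]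
        rw [h3] at h2
        exact h2
      · have : j.1 = n := by omega
        rw [this, P, Nat.sub_self, W, mul_one]
        exact ht a c
  have := ev_act y (vac d n (Y R d n q))
  rw [ev_vac, mul_one] at this
  rw [← this]
  exact key _

section Trace

variable (z : R) (w : ZMod d → R)

/-- The functional that defines the conditional expectation. -/
def eps (d n : ℕ) [NeZero d] (q : Rˣ) (z : R) (w : ZMod d → R) :
    Mod d n (Y R d n q) →ₗ[R] Y R d n q :=
  Finsupp.lsum R fun p => if p.1.1 = n then w p.2 • LinearMap.id else
    z • LinearMap.mulLeft R (P R (gT d n q) (tT d n q) (n - 1) p.1.1 p.2)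

theorem eps_last (a : ZMod d) (c : Y R d n q) : eps d n q z w (vec n n a c) = w a • c := by
  simp [eps, vec]

theorem eps_lt {j : ℕ} (hj : j < n) (a : ZMod d) (c : Y R d n q) : eps d n q z w (vec n j a c) =
    z • (P R (gT d n q) (tT d n q) (n - 1) j a * c) := by
  simp [eps, vec, Nat.mod_eq_of_lt (show j < n + 1 by omega), show ¬ j = n by omega]

theorem eps_g (i : ℕ) (h : i + 1 < n) (m) :
    eps d n q z w (act d n q (gT d (n + 1) q i) m) = gT d n q i * eps d n q z w m := by
  suffices h : (eps d n q z w).comp (act d n q (gT d (n + 1) q i)) =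
      (LinearMap.mulLeft R (gT d n q i)).comp (eps d n q z w) from LinearMap.congr_fun h m
  refine Mod.hom_ext fun j hj a c => ?_
  rw [act_gT i (by omega)]
  simp only [LinearMap.comp_apply, LinearMap.mulLeft_apply]
  obtain ⟨k, rfl⟩ : ∃ k, n = k + 1 := ⟨n - 1, by omega⟩
  have H := isRep_Y (R := R) (d := d) (n := k + 1) (q := q)
  rcases Nat.lt_or_ge j (k + 1) with hj' | hj'
  · rcases lt_trichotomy j i with h1 | h1 | h1
    · rw [opG_high h1 hj, eps_lt _ _ hj', eps_lt _ _ hj', ← mul_assoc, mul_smul_comm,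
        ← mul_assoc (gT d (k + 1) q i), Nat.add_sub_cancel, H.g_P_high i j h1 (by omega)]
    · subst h1
      rw [opG_eq hj, map_add, map_smul, eps_lt _ _ hj', eps_lt _ _ h, eps_lt _ _ hj',
        mul_smul_comm, ← mul_assoc (gT d (k + 1) q j), Nat.add_sub_cancel,
        H.g_P_eq j (by omega), add_mul, smul_add, smul_mul_assoc, smul_comm z, ← mul_assoc]
    · by_cases h2 : j = i + 1
      · subst h2
        rw [opG_succ hj, eps_lt _ _ hj', eps_lt _ _ (by omega), mul_smul_comm, ← mul_assoc,
          Nat.add_sub_cancel, H.g_P_succ i (by omega)]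
      · rw [opG_low (by omega) hj, eps_lt _ _ hj', eps_lt _ _ hj', mul_smul_comm, ← mul_assoc,
          ← mul_assoc, Nat.add_sub_cancel, H.g_P_low i j (by omega) (by omega)]
  · have : j = k + 1 := by omega
    subst this
    rw [opG_low h le_rfl, eps_last, eps_last, mul_smul_comm]

theorem eps_t (i : ℕ) (h : i < n) (m) :
    eps d n q z w (act d n q (tT d (n + 1) q i) m) = tT d n q i * eps d n q z w m := by
  suffices h : (eps d n q z w).comp (act d n q (tT d (n + 1) q i)) =
      (LinearMap.mulLeft R (tT d n q i)).comp (eps d n q z w) from LinearMap.congr_fun h m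
  refine Mod.hom_ext fun j hj a c => ?_
  rw [act_tT i (by omega)]
  simp only [LinearMap.comp_apply, LinearMap.mulLeft_apply, opD_vec _ j hj, uT]
  obtain ⟨k, rfl⟩ : ∃ k, n = k + 1 := ⟨n - 1, by omega⟩
  have H := isRep_Y (R := R) (d := d) (n := k + 1) (q := q)
  rcases Nat.lt_or_ge j (k + 1) with hj' | hj'
  · rw [eps_lt _ _ hj', eps_lt _ _ hj', mul_smul_comm, ← mul_assoc, ← mul_assoc,
      Nat.add_sub_cancel]
    rcases lt_trichotomy j i with h1 | h1 | h1
    · rw [if_neg (by omega), if_neg (by omega), H.t_P_high i j h1 (by omega)]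
    · subst h1
      rw [if_pos rfl, H.t_P_eq j (by omega), mul_smul_comm, mul_one]
    · rw [if_neg (by omega), if_pos h1, H.t_P_low i j h1 (by omega)]
  · have : j = k + 1 := by omega
    subst this
    rw [if_neg (by omega), if_pos h, eps_last, eps_last, mul_smul_comm]

theorem eps_incl (c : Y R d n q) : ∀ m,
    eps d n q z w (act d n q (incl d n q c) m) = c * eps d n q z w m := by
  let S : Subalgebra R (Y R d n q) :=
    { carrier := {c | ∀ m, eps d n q z w (act d n q (incl d n q c) m) = c * eps d n q z w m}
      mul_mem' := fun {x y} hx hy m => by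
        rw [map_mul, map_mul, Module.End.mul_apply, hx, hy, mul_assoc]
      add_mem' := fun {x y} hx hy m => by
        rw [map_add, map_add, LinearMap.add_apply, map_add, hx, hy, add_mul]
      algebraMap_mem' := fun r m => by
        rw [AlgHom.commutes, AlgHom.commutes, Module.algebraMap_end_apply, map_smul,
          Algebra.smul_def] }
  refine Y.mem_of_gen S (fun i hi m => ?_) (fun i hi m => ?_) c
  · rw [incl_gT i hi, eps_g z w i hi]
  · rw [incl_tT i hi, eps_t z w i hi]

/-- Right multiplication on the free module. -/
def rmul (n : ℕ) (b : B) : Mod d n B →ₗ[R] Mod d n B :=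
  Finsupp.mapRange.linearMap (LinearMap.mulRight R b)

theorem rmul_vec (b : B) (j : ℕ) (a : ZMod d) (c : B) :
    rmul (R := R) n b (vec n j a c) = vec n j a (c * b) := by
  simp [rmul, vec]

theorem act_rmul (b : Y R d n q) (y : Y R d (n + 1) q) : ∀ m,
    act d n q y (rmul (R := R) n b m) = rmul (R := R) n b (act d n q y m) := by
  let S : Subalgebra R (Y R d (n + 1) q) :=
    { carrier := {y | ∀ m, act d n q y (rmul (R := R) n b m) =
        rmul (R := R) n b (act d n q y m)}
      mul_mem' := fun {x y} hx hy m => by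
        rw [map_mul, Module.End.mul_apply, Module.End.mul_apply, hy, hx]
      add_mem' := fun {x y} hx hy m => by
        rw [map_add, LinearMap.add_apply, LinearMap.add_apply, map_add, hx, hy]
      algebraMap_mem' := fun r m => by
        rw [AlgHom.commutes, Module.algebraMap_end_apply, Module.algebraMap_end_apply, map_smul] }
  refine Y.mem_of_gen S (fun i hi => ?_) (fun i hi => ?_) y
  · suffices h : (act d n q (gT d (n + 1) q i)).comp (rmul (R := R) n b) =
        (rmul (R := R) n b).comp (act d n q (gT d (n + 1) q i)) from
      fun m => LinearMap.congr_fun h m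
    refine Mod.hom_ext fun j hj a c => ?_
    rw [act_gT i (by omega)]
    simp only [LinearMap.comp_apply, rmul_vec]
    rcases lt_trichotomy j i with h1 | h1 | h1
    · rw [opG_high h1 hj, opG_high h1 hj, rmul_vec, mul_assoc]
    · subst h1
      rw [opG_eq hj, opG_eq hj, map_add, map_smul, rmul_vec, rmul_vec, mul_assoc]
    · by_cases h2 : j = i + 1
      · subst h2
        rw [opG_succ hj, opG_succ hj, rmul_vec]
      · rw [opG_low (by omega) hj, opG_low (by omega) hj, rmul_vec, mul_assoc]
  · suffices h : (act d n q (tT d (n + 1) q i)).comp (rmul (R := R) n b) =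
        (rmul (R := R) n b).comp (act d n q (tT d (n + 1) q i)) from
      fun m => LinearMap.congr_fun h m
    refine Mod.hom_ext fun j hj a c => ?_
    rw [act_tT i (by omega)]
    simp only [LinearMap.comp_apply, rmul_vec, opD_vec _ j hj, mul_assoc]

theorem eps_rmul (b : Y R d n q) (m) :
    eps d n q z w (rmul (R := R) n b m) = eps d n q z w m * b := by
  suffices h : (eps d n q z w).comp (rmul (R := R) n b) =
      (LinearMap.mulRight R b).comp (eps d n q z w) from LinearMap.congr_fun h m
  refine Mod.hom_ext fun j hj a c => ?_
  simp only [LinearMap.comp_apply, rmul_vec, LinearMap.mulRight_apply]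
  rcases Nat.lt_or_ge j n with hj' | hj'
  · rw [eps_lt _ _ hj', eps_lt _ _ hj', smul_mul_assoc, mul_assoc]
  · have : j = n := by omega
    subst this
    rw [eps_last, eps_last, smul_mul_assoc]

theorem act_incl_vac (c : Y R d n q) : act d n q (incl d n q c) (vac d n _) =
    rmul (R := R) n c (vac d n _) := by
  let S : Subalgebra R (Y R d n q) :=
    { carrier := {c | act d n q (incl d n q c) (vac d n _) = rmul (R := R) n c (vac d n _)}
      mul_mem' := fun {x y} hx hy => by
        change _ = _ at hx hy
        change _ = _
        rw [map_mul, map_mul, Module.End.mul_apply, hy, act_rmul, hx]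
        simp [vac, rmul_vec]
      add_mem' := fun {x y} hx hy => by
        change _ = _ at hx hy
        change _ = _
        rw [map_add, map_add, LinearMap.add_apply, hx, hy]
        simp [vac, rmul_vec, vec_add, Finset.sum_add_distrib]
      algebraMap_mem' := fun r => by
        change _ = _
        rw [AlgHom.commutes, AlgHom.commutes, Module.algebraMap_end_apply]
        simp [vac, rmul_vec, Finset.smul_sum, ← vec_smul, Algebra.algebraMap_eq_smul_one] }
  refine Y.mem_of_gen S (fun i hi => ?_) (fun i hi => ?_) c
  · change _ = _
    rw [incl_gT i hi, act_gT i (by omega), vac, map_sum, map_sum]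
    refine Finset.sum_congr rfl fun a _ => ?_
    rw [opG_low hi le_rfl, rmul_vec, mul_one, one_mul]
  · change _ = _
    rw [incl_tT i hi, act_tT i (by omega), vac, map_sum, map_sum]
    refine Finset.sum_congr rfl fun a _ => ?_
    rw [opD_vec _ _ le_rfl, uT, if_neg (by omega), if_pos hi, rmul_vec, mul_one, one_mul]

/-- The conditional expectation `Y_{d,n+1}(q) → Y_{d,n}(q)`. -/
def cexp (d n : ℕ) [NeZero d] (q : Rˣ) (z : R) (w : ZMod d → R) :
    Y R d (n + 1) q →ₗ[R] Y R d n q :=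
  (eps d n q z w).comp ((LinearMap.applyₗ (vac d n (Y R d n q))).comp (act d n q).toLinearMap)

theorem cexp_apply (y : Y R d (n + 1) q) :
    cexp d n q z w y = eps d n q z w (act d n q y (vac d n _)) := rfl

theorem cexp_incl_mul (c : Y R d n q) (y : Y R d (n + 1) q) :
    cexp d n q z w (incl d n q c * y) = c * cexp d n q z w y := by
  rw [cexp_apply, map_mul, Module.End.mul_apply, eps_incl, cexp_apply]

theorem cexp_mul_incl (c : Y R d n q) (y : Y R d (n + 1) q) :
    cexp d n q z w (y * incl d n q c) = cexp d n q z w y * c := by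
  rw [cexp_apply, map_mul, Module.End.mul_apply, act_incl_vac, act_rmul, eps_rmul, cexp_apply]

theorem cexp_one (hw : ∑ a, w a = 1) : cexp d n q z w 1 = 1 := by
  rw [cexp_apply, map_one, Module.End.one_apply, vac, map_sum]
  simp only [eps_last]
  rw [← Finset.sum_smul, hw, one_smul]

theorem cexp_g (hn : 1 ≤ n) : cexp d n q z w (gT d (n + 1) q (n - 1)) = z • 1 := by
  obtain ⟨k, rfl⟩ : ∃ k, n = k + 1 := ⟨n - 1, by omega⟩
  rw [cexp_apply, act_gT _ (by omega), vac, map_sum, map_sum, Nat.add_sub_cancel]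
  have : ∀ a : ZMod d, eps d (k + 1) q z w (opG (k + 1) ((q : R) - ((q⁻¹ : Rˣ) : R))
      (gT d (k + 1) q) (tT d (k + 1) q) k (vec (k + 1) (k + 1) a 1)) =
      z • pB R (tT d (k + 1) q k) a := fun a => by
    rw [opG_succ le_rfl, eps_lt _ _ (by omega), P, Nat.add_sub_cancel, Nat.sub_self, W, mul_one,
      mul_one]
  rw [Finset.sum_congr rfl fun a _ => this a, ← Finset.smul_sum, sum_pB]

theorem cexp_t_pow (s : ℕ) : cexp d n q z w (tT d (n + 1) q n ^ s) =
    (∑ a, chi R ((s : ZMod d) * a) * w a) • 1 := by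
  rw [cexp_apply, map_pow, act_tT _ le_rfl, opD_pow, vac, map_sum, map_sum, Finset.sum_smul]
  refine Finset.sum_congr rfl fun a _ => ?_
  rw [opD_vec _ _ le_rfl, uT, if_pos rfl, mul_one, eps_last, smul_pow, one_pow, chi_nsmul, smul_smul,
    mul_comm]

theorem cexp_p (a : ZMod d) : cexp d n q z w (pB R (tT d (n + 1) q n) a) = w a • 1 := by
  rw [pB, map_smul, map_sum]
  simp only [map_smul, cexp_t_pow, smul_smul, ZMod.natCast_zmod_val]
  rw [← Finset.sum_smul, smul_smul]
  congr 1
  simp only [Finset.mul_sum]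
  rw [Finset.sum_comm]
  have : ∀ b : ZMod d, ∑ s : ZMod d, invd R d * (chi R (-(s * a)) * (chi R (s * b) * w b)) =
      if b = a then w b else 0 := fun b => by
    have h := sum_chi (R := R) (b - a)
    rw [Finset.mul_sum] at h
    have h2 : ∀ s : ZMod d, invd R d * (chi R (-(s * a)) * (chi R (s * b) * w b)) =
        invd R d * chi R (s * (b - a)) * w b := fun s => by
      rw [← mul_assoc (chi R _), ← chi_add, ← mul_assoc]
      congr 3; ring
    rw [Finset.sum_congr rfl fun s _ => h2 s, ← Finset.sum_mul, h]
    by_cases hb : b = a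
    · simp [hb]
    · simp [hb, sub_ne_zero.2 hb]
  rw [Finset.sum_congr rfl fun b _ => this b]
  simp

theorem commute_incl {x : Y R d (n + 1) q} (hg : ∀ i, i + 1 < n → Commute x (gT d (n + 1) q i))
    (ht : ∀ i, i < n → Commute x (tT d (n + 1) q i)) (c : Y R d n q) :
    Commute x (incl d n q c) := by
  let S : Subalgebra R (Y R d n q) :=
    { carrier := {c | Commute x (incl d n q c)}
      mul_mem' := fun {a b} ha hb => by
        change Commute _ _
        rw [map_mul]; exact Commute.mul_right ha hb
      add_mem' := fun {a b} ha hb => by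
        change Commute _ _
        rw [map_add]; exact Commute.add_right ha hb
      algebraMap_mem' := fun r => by
        change Commute _ _
        rw [AlgHom.commutes]; exact (Algebra.commutes r x).symm }
  refine Y.mem_of_gen S (fun i hi => ?_) (fun i hi => ?_) c
  · change Commute _ _
    rw [incl_gT i hi]; exact hg i hi
  · change Commute _ _
    rw [incl_tT i hi]; exact ht i hi

theorem t_commute_incl (c : Y R d n q) : Commute (tT d (n + 1) q n) (incl d n q c) :=
  commute_incl (fun i hi => isRep_Y.tg i n (by omega) (by omega) (by omega) (by omega))
    (fun i hi => isRep_Y.tt n i (by omega) (by omega)) c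

theorem g_commute_incl (c : Y R d n q) :
    Commute (gT d (n + 1 + 1) q n) (incl d (n + 1) q (incl d n q c)) := by
  have H := isRep_Y (R := R) (d := d) (n := n + 1 + 1) (q := q)
  let S : Subalgebra R (Y R d n q) :=
    { carrier := {c | Commute (gT d (n + 1 + 1) q n) (incl d (n + 1) q (incl d n q c))}
      mul_mem' := fun {a b} ha hb => by
        change Commute _ _
        rw [map_mul, map_mul]; exact Commute.mul_right ha hb
      add_mem' := fun {a b} ha hb => by
        change Commute _ _
        rw [map_add, map_add]; exact Commute.add_right ha hb
      algebraMap_mem' := fun r => by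
        change Commute _ _
        rw [AlgHom.commutes, AlgHom.commutes]; exact (Algebra.commutes r _).symm }
  refine Y.mem_of_gen S (fun i hi => ?_) (fun i hi => ?_) c
  · change Commute _ _
    rw [incl_gT i hi, incl_gT i (by omega)]
    exact (H.far i n (by omega) (by omega)).symm
  · change Commute _ _
    rw [incl_tT i hi, incl_tT i (by omega)]
    exact (H.tg n i (by omega) (by omega) (by omega) (by omega)).symm

/-! ### The trace -/

theorem isRep_zero : IsRep (B := R) d 0 ((q : R) - ((q⁻¹ : Rˣ) : R)) (fun _ => 0) (fun _ => 0) where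
  braid i h := by omega
  far i j h h' := by omega
  tt i j h h' := by omega
  tg0 i h := by omega
  tg1 i h := by omega
  tg i j h h' := by omega
  td j h := by omega
  quad i h := by omega

/-- The trace, built from the conditional expectations. -/
def tau (d : ℕ) [NeZero d] (q : Rˣ) (z : R) (w : ZMod d → R) : ∀ n, Y R d n q →ₗ[R] R
  | 0 => (Y.lift (isRep_zero (R := R) (d := d) (q := q))).toLinearMap
  | n + 1 => (tau d q z w n).comp (cexp d n q z w)

theorem tau_succ (y : Y R d (n + 1) q) :
    tau d q z w (n + 1) y = tau d q z w n (cexp d n q z w y) := rfl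

theorem cexp_pg (k : ℕ) (a : ZMod d) :
    cexp d (k + 1) q z w (pB R (tT d (k + 1 + 1) q (k + 1)) a * gT d (k + 1 + 1) q k) =
      z • pB R (tT d (k + 1) q k) a := by
  have H := isRep_Y (R := R) (d := d) (n := k + 1 + 1) (q := q)
  have hp : incl d (k + 1) q (pB R (tT d (k + 1) q k) a) = pB R (tT d (k + 1 + 1) q k) a := by
    simp [pB, incl_tT k (show k < k + 1 by omega)]
  have hg := cexp_g (d := d) (q := q) z w (show 1 ≤ k + 1 by omega)
  rw [Nat.add_sub_cancel] at hg
  rw [← H.g_p1 k (by omega), ← hp, cexp_mul_incl, hg, smul_mul_assoc, one_mul]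

theorem p_incl (k : ℕ) (a : ZMod d) :
    incl d (k + 1) q (pB R (tT d (k + 1) q k) a) = pB R (tT d (k + 1 + 1) q k) a := by
  simp [pB, incl_tT k (show k < k + 1 by omega)]

theorem mul_eB_comm {x y : B} (h : Commute x y) (a : ZMod d) :
    pB R y a * eB R d x y = eB R d x y * pB R y a := by
  rw [eB, smul_mul_assoc, mul_smul_comm, Finset.mul_sum, Finset.sum_mul]
  congr 1
  refine Finset.sum_congr rfl fun s _ => ?_
  refine Commute.eq (Commute.mul_right ?_ ?_)
  · exact (pB_commute (h.pow_left _) a).symm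
  · exact (pB_commute ((Commute.refl _).pow_left _) a).symm

theorem cexp_peg (k : ℕ) (a : ZMod d) :
    cexp d (k + 1) q z w (pB R (tT d (k + 1 + 1) q (k + 1)) a *
      (eB R d (tT d (k + 1 + 1) q k) (tT d (k + 1 + 1) q (k + 1)) * gT d (k + 1 + 1) q k)) =
      z • pB R (tT d (k + 1) q k) a := by
  have H := isRep_Y (R := R) (d := d) (n := k + 1 + 1) (q := q)
  rw [← mul_assoc, mul_eB_comm (H.tt _ _ (by omega) (by omega)),
    eB_mul_pB_right (H.td _ (by omega)), mul_assoc, ← p_incl, cexp_incl_mul, cexp_pg,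
    mul_smul_comm, pB_idem ((isRep_Y (n := k + 1)).td _ (by omega))]

/-- The sandwich map `b ↦ E(g b g)`. -/
def sand (d k : ℕ) [NeZero d] (q : Rˣ) (z : R) (w : ZMod d → R) (b : Y R d (k + 1) q) :
    Y R d (k + 1) q :=
  cexp d (k + 1) q z w (gT d (k + 1 + 1) q k * incl d (k + 1) q b * gT d (k + 1 + 1) q k)

theorem sand_add (k : ℕ) (b c : Y R d (k + 1) q) :
    sand d k q z w (b + c) = sand d k q z w b + sand d k q z w c := by
  simp [sand, mul_add, add_mul]

theorem sand_zero (k : ℕ) : sand d k q z w 0 = 0 := by simp [sand]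

theorem sand_bimod (k : ℕ) (x y : Y R d k q) (b : Y R d (k + 1) q) :
    sand d k q z w (incl d k q x * b * incl d k q y) =
      incl d k q x * sand d k q z w b * incl d k q y := by
  have h1 := (g_commute_incl x).eq
  have h2 := (g_commute_incl y).eq
  have : gT d (k + 1 + 1) q k * incl d (k + 1) q (incl d k q x * b * incl d k q y) *
      gT d (k + 1 + 1) q k = incl d (k + 1) q (incl d k q x) *
      (gT d (k + 1 + 1) q k * incl d (k + 1) q b * gT d (k + 1 + 1) q k *
        incl d (k + 1) q (incl d k q y)) := by
    simp only [map_mul, mul_assoc, h2]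
    simp only [← mul_assoc, h1]
  rw [sand, this, cexp_incl_mul, cexp_mul_incl, sand, ← mul_assoc]

theorem sand_left (k : ℕ) (x : Y R d k q) (b : Y R d (k + 1) q) :
    sand d k q z w (incl d k q x * b) = incl d k q x * sand d k q z w b := by
  simpa using sand_bimod z w k x 1 b

theorem sand_right (k : ℕ) (y : Y R d k q) (b : Y R d (k + 1) q) :
    sand d k q z w (b * incl d k q y) = sand d k q z w b * incl d k q y := by
  simpa using sand_bimod z w k 1 y b

theorem sand_p (k : ℕ) (a : ZMod d) :
    sand d k q z w (pB R (tT d (k + 1) q k) a) =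
      w a • 1 + (((q : R) - ((q⁻¹ : Rˣ) : R)) * z) • pB R (tT d (k + 1) q k) a := by
  have H := isRep_Y (R := R) (d := d) (n := k + 1 + 1) (q := q)
  rw [sand, p_incl, H.g_p1 k (by omega), mul_assoc, H.quad k (by omega), mul_add, mul_one, map_add,
    mul_smul_comm, map_smul, cexp_peg, cexp_p, smul_smul]

theorem sand_g (k : ℕ) : sand d (k + 1) q z w (gT d (k + 1 + 1) q k) =
    z • (gT d (k + 1 + 1) q k * gT d (k + 1 + 1) q k) := by
  have H := isRep_Y (R := R) (d := d) (n := k + 1 + 1 + 1) (q := q)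
  have hg := cexp_g (d := d) (q := q) z w (show 1 ≤ k + 1 + 1 by omega)
  rw [Nat.add_sub_cancel] at hg
  rw [sand, incl_gT k (by omega), ← H.braid k (by omega), ← incl_gT k (show k + 1 < k + 1 + 1 by omega),
    cexp_mul_incl, cexp_incl_mul, hg, mul_smul_comm, mul_one, smul_mul_assoc]

/-- The trace condition in a fixed degree. -/
def Tracial (d : ℕ) [NeZero d] (q : Rˣ) (z : R) (w : ZMod d → R) (n : ℕ) : Prop :=
  ∀ x y : Y R d n q, tau d q z w n (x * y) = tau d q z w n (y * x)

theorem sand_symm_p (k : ℕ) (a : ZMod d)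
    (c : Y R d (k + 1) q) :
    tau d q z w (k + 1) (sand d k q z w (pB R (tT d (k + 1) q k) a) * c) =
      tau d q z w (k + 1) (pB R (tT d (k + 1) q k) a * sand d k q z w c) := by
  have H := isRep_Y (R := R) (d := d) (n := k + 1) (q := q)
  induction c using span_induction with
  | hadd x y hx hy => rw [mul_add, map_add, hx, hy, sand_add, mul_add, map_add]
  | h0 => rw [sand_zero, mul_zero, mul_zero]
  | ht b c =>
    have hA : ∀ b : ZMod d, tau d q z w (k + 1) (pB R (tT d (k + 1) q k) b * incl d k q c) =
        w b * tau d q z w k c := fun b => by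
      rw [tau_succ, cexp_mul_incl, cexp_p, smul_mul_assoc, one_mul, map_smul, smul_eq_mul]
    rw [sand_right, sand_p z w, sand_p z w, add_mul, add_mul, mul_add, map_add, map_add,
      smul_mul_assoc, smul_mul_assoc, smul_mul_assoc, smul_mul_assoc, mul_smul_comm, mul_smul_comm,
      one_mul, one_mul]
    simp only [map_smul, hA, smul_eq_mul]
    ring
  | hg hk c1 c2 =>
    obtain ⟨l, rfl⟩ : ∃ l, k = l + 1 := ⟨k - 1, by omega⟩
    rw [Nat.add_sub_cancel]
    have hc1 : pB R (tT d (l + 1 + 1) q (l + 1)) a * incl d (l + 1) q c1 =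
        incl d (l + 1) q c1 * pB R (tT d (l + 1 + 1) q (l + 1)) a :=
      (pB_commute (t_commute_incl c1).symm a).eq.symm
    have hg := cexp_g (d := d) (q := q) z w (show 1 ≤ l + 1 by omega)
    rw [Nat.add_sub_cancel] at hg
    have f1 : cexp d (l + 1) q z w (incl d (l + 1) q c1 * gT d (l + 1 + 1) q l *
        incl d (l + 1) q c2) = z • (c1 * c2) := by
      rw [cexp_mul_incl, cexp_incl_mul, hg, mul_smul_comm, mul_one, smul_mul_assoc]
    have f2 : cexp d (l + 1) q z w (pB R (tT d (l + 1 + 1) q (l + 1)) a *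
        (incl d (l + 1) q c1 * gT d (l + 1 + 1) q l * incl d (l + 1) q c2)) =
        z • (c1 * pB R (tT d (l + 1) q l) a * c2) := by
      rw [← mul_assoc, ← mul_assoc, hc1, cexp_mul_incl, mul_assoc (incl _ _ _ _), cexp_incl_mul,
        cexp_pg, mul_smul_comm, smul_mul_assoc]
    have f3 : cexp d (l + 1) q z w (pB R (tT d (l + 1 + 1) q (l + 1)) a *
        (incl d (l + 1) q c1 * incl d (l + 1) q c2)) = w a • (c1 * c2) := by
      rw [← map_mul, cexp_mul_incl, cexp_p, smul_mul_assoc, one_mul]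
    have f4 : cexp d (l + 1) q z w (pB R (tT d (l + 1 + 1) q (l + 1)) a *
        (incl d (l + 1) q c1 * (eB R d (tT d (l + 1 + 1) q l) (tT d (l + 1 + 1) q (l + 1)) *
          gT d (l + 1 + 1) q l) * incl d (l + 1) q c2)) =
        z • (c1 * pB R (tT d (l + 1) q l) a * c2) := by
      rw [← mul_assoc, ← mul_assoc, hc1, cexp_mul_incl, mul_assoc (incl _ _ _ _), cexp_incl_mul,
        cexp_peg, mul_smul_comm, smul_mul_assoc]
    have g1 : incl d (l + 1) q c1 * (z • (gT d (l + 1 + 1) q l * gT d (l + 1 + 1) q l)) *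
        incl d (l + 1) q c2 = z • (incl d (l + 1) q c1 * incl d (l + 1) q c2) +
        (z * ((q : R) - ((q⁻¹ : Rˣ) : R))) • (incl d (l + 1) q c1 *
          (eB R d (tT d (l + 1 + 1) q l) (tT d (l + 1 + 1) q (l + 1)) *
          gT d (l + 1 + 1) q l) * incl d (l + 1) q c2) := by
      rw [H.quad l (by omega), smul_add, mul_add, add_mul, mul_smul_comm, mul_one, smul_mul_assoc,
        mul_smul_comm, mul_smul_comm, smul_mul_assoc, smul_mul_assoc, smul_smul]
    rw [sand_bimod, sand_g, sand_p z w, g1, add_mul, mul_add, smul_mul_assoc, smul_mul_assoc,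
      mul_smul_comm, mul_smul_comm, one_mul]
    simp only [map_add, map_smul, tau_succ z w (n := l + 1), f1, f2, f3, f4, smul_eq_mul]
    ring

theorem sand_symm_g (k : ℕ) (hT : Tracial d q z w (k + 1 + 1)) (c1 c2 : Y R d (k + 1) q) :
    tau d q z w (k + 1 + 1) (gT d (k + 1 + 1) q k * gT d (k + 1 + 1) q k *
      (incl d (k + 1) q c1 * gT d (k + 1 + 1) q k * incl d (k + 1) q c2)) =
    tau d q z w (k + 1 + 1) (gT d (k + 1 + 1) q k * (incl d (k + 1) q c1 *
      (gT d (k + 1 + 1) q k * gT d (k + 1 + 1) q k) * incl d (k + 1) q c2)) := by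
  have H := isRep_Y (R := R) (d := d) (n := k + 1 + 1) (q := q)
  have hg := cexp_g (d := d) (q := q) z w (show 1 ≤ k + 1 by omega)
  rw [Nat.add_sub_cancel] at hg
  set h := gT d (k + 1 + 1) q k with hh
  set b1 := incl d (k + 1) q c1 with hb1
  set b2 := incl d (k + 1) q c2 with hb2
  set t0 := tT d (k + 1 + 1) q k with ht0
  set t1 := tT d (k + 1 + 1) q (k + 1) with ht1
  have hX : Commute t0 (h * b1 * h) := by
    have e1 : t0 * h = h * t1 := H.tg0 k (by omega)
    have e2 : t1 * b1 = b1 * t1 := (t_commute_incl c1).eq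
    have e3 : t1 * h = h * t0 := H.tg1 k (by omega)
    change t0 * (h * b1 * h) = h * b1 * h * t0
    rw [← mul_assoc, ← mul_assoc, e1, mul_assoc h t1, e2, mul_assoc, mul_assoc b1, e3]
    simp only [mul_assoc]
  have h12 : Commute t1 b2 := t_commute_incl c2
  have h01 : Commute t0 t1 := H.tt _ _ (by omega) (by omega)
  have he : tau d q z w (k + 1 + 1) (eB R d t0 t1 * (h * b1 * h * b2)) =
      tau d q z w (k + 1 + 1) (h * b1 * h * eB R d t0 t1 * b2) := by
    rw [eB, smul_mul_assoc, mul_smul_comm, smul_mul_assoc, map_smul, map_smul, Finset.sum_mul,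
      Finset.mul_sum, Finset.sum_mul, map_sum, map_sum]
    congr 1
    refine Finset.sum_congr rfl fun s _ => ?_
    have f1 := (h01.pow_pow s.val (-s).val).eq
    have f2 := (hX.pow_left s.val).eq
    have f3 := (h12.pow_left (-s).val).eq
    calc _ = tau d q z w (k + 1 + 1) (t1 ^ (-s).val * (t0 ^ s.val * (h * b1 * h) * b2)) := by
          rw [f1]; simp only [mul_assoc]
      _ = tau d q z w (k + 1 + 1) (t0 ^ s.val * (h * b1 * h) * b2 * t1 ^ (-s).val) := hT _ _
      _ = _ := by rw [f2, mul_assoc _ b2, ← f3]; simp only [mul_assoc]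
  have e1 : h * h * (b1 * h * b2) = b1 * h * b2 +
      ((q : R) - ((q⁻¹ : Rˣ) : R)) • (eB R d t0 t1 * (h * b1 * h * b2)) := by
    rw [H.quad k (by omega), add_mul, one_mul, smul_mul_assoc]
    simp only [mul_assoc]
    rfl
  have e2 : h * (b1 * (h * h) * b2) = h * b1 * b2 +
      ((q : R) - ((q⁻¹ : Rˣ) : R)) • (h * b1 * h * eB R d t0 t1 * b2) := by
    rw [H.quad k (by omega), H.e_comm k (by omega), mul_add, add_mul, mul_add, mul_one,
      mul_smul_comm, smul_mul_assoc, mul_smul_comm]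
    simp only [mul_assoc]
    rfl
  have e3 : tau d q z w (k + 1 + 1) (b1 * h * b2) = tau d q z w (k + 1 + 1) (h * b1 * b2) := by
    rw [tau_succ (n := k + 1), tau_succ (n := k + 1), hb1, hb2, mul_assoc h, ← map_mul, cexp_mul_incl, cexp_mul_incl,
      cexp_incl_mul, hg, smul_mul_assoc, mul_smul_comm, smul_mul_assoc, one_mul, mul_one]
  rw [e1, e2, map_add, map_add, map_smul, map_smul, he, e3]

theorem sand_symm (k : ℕ) (hT : Tracial d q z w (k + 1))
    (b c : Y R d (k + 1) q) :
    tau d q z w (k + 1) (sand d k q z w b * c) = tau d q z w (k + 1) (b * sand d k q z w c) := by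
  induction b using span_induction generalizing c with
  | hadd x y hx hy => rw [sand_add, add_mul, map_add, hx, hy, add_mul, map_add]
  | h0 => rw [sand_zero, zero_mul, zero_mul]
  | ht a b' =>
    rw [sand_right, mul_assoc, sand_symm_p z w k, sand_left, mul_assoc]
  | hg hk b1 b2 =>
    obtain ⟨l, rfl⟩ : ∃ l, k = l + 1 := ⟨k - 1, by omega⟩
    rw [Nat.add_sub_cancel]
    have key : ∀ c, tau d q z w (l + 1 + 1) (sand d (l + 1) q z w (gT d (l + 1 + 1) q l) * c) =
        tau d q z w (l + 1 + 1) (gT d (l + 1 + 1) q l * sand d (l + 1) q z w c) := fun c => by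
      induction c using span_induction with
      | hadd x y hx hy => rw [mul_add, map_add, hx, hy, sand_add, mul_add, map_add]
      | h0 => rw [sand_zero, mul_zero, mul_zero]
      | ht a c =>
        have := sand_symm_p z w (l + 1) a (incl d (l + 1) q c * gT d (l + 1 + 1) q l)
        rw [sand_left, ← mul_assoc, ← mul_assoc] at this
        rw [sand_right, hT, hT (gT d (l + 1 + 1) q l), this]
      | hg hk c1 c2 =>
        rw [Nat.add_sub_cancel, sand_bimod, sand_g, smul_mul_assoc, mul_smul_comm, smul_mul_assoc,
          mul_smul_comm, map_smul, map_smul, sand_symm_g z w l hT]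
    have h1 := key (incl d (l + 1) q b2 * c * incl d (l + 1) q b1)
    rw [sand_bimod] at h1 ⊢
    calc _ = tau d q z w (l + 1 + 1) (sand d (l + 1) q z w (gT d (l + 1 + 1) q l) *
          (incl d (l + 1) q b2 * c * incl d (l + 1) q b1)) := by
          rw [mul_assoc, mul_assoc, hT]; simp only [mul_assoc]
      _ = _ := h1
      _ = _ := by
          rw [mul_assoc (incl d (l + 1) q b1), mul_assoc (incl d (l + 1) q b1),
            hT (incl d (l + 1) q b1)]
          simp only [mul_assoc]

theorem tracial : ∀ n, Tracial d q z w n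
  | 0 => fun x y => by
    change Y.lift _ _ = Y.lift _ _
    rw [map_mul, map_mul, mul_comm]
  | n + 1 => fun x => by
    have hT := tracial n
    have hincl : ∀ (c : Y R d n q) y, tau d q z w (n + 1) (incl d n q c * y) =
        tau d q z w (n + 1) (y * incl d n q c) := fun c y => by
      rw [tau_succ, tau_succ, cexp_incl_mul, cexp_mul_incl, hT]
    have H := isRep_Y (R := R) (d := d) (n := n + 1) (q := q)
    let S : Subalgebra R (Y R d (n + 1) q) :=
      { carrier := {x | ∀ y, tau d q z w (n + 1) (x * y) = tau d q z w (n + 1) (y * x)}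
        mul_mem' := fun {a b} ha hb y => by
          rw [mul_assoc, ha, mul_assoc, hb, mul_assoc]
        add_mem' := fun {a b} ha hb y => by
          rw [add_mul, mul_add, map_add, map_add, ha, hb]
        algebraMap_mem' := fun r y => by
          rw [Algebra.commutes] }
    refine Y.mem_of_gen S (fun i hi => ?_) (fun i hi => ?_) x
    · by_cases h : i + 1 < n
      · rw [← incl_gT i h]; exact hincl _
      obtain ⟨k, rfl⟩ : ∃ k, n = k + 1 := ⟨n - 1, by omega⟩
      have : i = k := by omega
      subst this
      intro y
      have hg := cexp_g (d := d) (q := q) z w (show 1 ≤ i + 1 by omega)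
      rw [Nat.add_sub_cancel] at hg
      induction y using span_induction with
      | hadd x y hx hy => rw [mul_add, add_mul, map_add, map_add, hx, hy]
      | h0 => rw [mul_zero, zero_mul]
      | ht a c =>
        have hc : pB R (tT d (i + 1 + 1) q (i + 1)) a * incl d (i + 1) q c =
            incl d (i + 1) q c * pB R (tT d (i + 1 + 1) q (i + 1)) a :=
          (pB_commute (t_commute_incl c).symm a).eq.symm
        rw [← mul_assoc, H.g_p0 i hi, hc, mul_assoc (incl _ _ _ c), tau_succ (n := i + 1), tau_succ (n := i + 1),
          cexp_mul_incl, cexp_incl_mul, cexp_pg, ← p_incl, cexp_incl_mul, hg, mul_smul_comm,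
          mul_one, hT]
      | hg hk b c =>
        have := sand_symm z w i hT b c
        rw [Nat.add_sub_cancel, tau_succ (n := i + 1), tau_succ (n := i + 1), ← mul_assoc, cexp_mul_incl, ← mul_assoc,
          mul_assoc (incl _ _ _ b), mul_assoc (incl _ _ _ b), cexp_incl_mul]
        exact this
    · by_cases h : i < n
      · rw [← incl_tT i h]; exact hincl _
      have : i = n := by omega
      subst this
      intro y
      induction y using span_induction with
      | hadd x y hx hy => rw [mul_add, add_mul, map_add, map_add, hx, hy]
      | h0 => rw [mul_zero, zero_mul]
      | ht a c =>
        have : Commute (tT d (i + 1) q i) (pB R (tT d (i + 1) q i) a * incl d i q c) :=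
          Commute.mul_right (pB_commute (Commute.refl _) a) (t_commute_incl c)
        rw [this.eq]
      | hg hk b c =>
        obtain ⟨k, rfl⟩ : ∃ k, i = k + 1 := ⟨i - 1, by omega⟩
        rw [Nat.add_sub_cancel]
        have hg := cexp_g (d := d) (q := q) z w (show 1 ≤ k + 1 by omega)
        rw [Nat.add_sub_cancel] at hg
        have hb := (t_commute_incl b).eq
        have hc := (t_commute_incl c).eq
        have e1 : tT d (k + 1 + 1) q (k + 1) * (incl d (k + 1) q b * gT d (k + 1 + 1) q k *
            incl d (k + 1) q c) = incl d (k + 1) q b * gT d (k + 1 + 1) q k *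
              incl d (k + 1) q (tT d (k + 1) q k * c) := by
          rw [← mul_assoc, ← mul_assoc, hb, mul_assoc _ (tT _ _ _ _), H.tg1 k (by omega), map_mul,
            incl_tT k (by omega)]
          simp only [mul_assoc]
        have e2 : (incl d (k + 1) q b * gT d (k + 1 + 1) q k * incl d (k + 1) q c) *
            tT d (k + 1 + 1) q (k + 1) = incl d (k + 1) q (b * tT d (k + 1) q k) *
              gT d (k + 1 + 1) q k * incl d (k + 1) q c := by
          rw [mul_assoc, ← hc, ← mul_assoc, mul_assoc _ (gT _ _ _ _), ← H.tg0 k (by omega), map_mul,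
            incl_tT k (by omega)]
          simp only [mul_assoc]
        rw [e1, e2, tau_succ (n := k + 1), tau_succ (n := k + 1), cexp_mul_incl, cexp_mul_incl, cexp_incl_mul, cexp_incl_mul, hg]
        simp only [mul_smul_comm, smul_mul_assoc, mul_one, mul_assoc]

theorem tau_incl (hw : ∑ a, w a = 1) (c : Y R d n q) :
    tau d q z w (n + 1) (incl d n q c) = tau d q z w n c := by
  have := cexp_mul_incl z w c 1
  rw [one_mul, cexp_one z w hw, one_mul] at this
  rw [tau_succ, this]

theorem tau_one (hw : ∑ a, w a = 1) : ∀ n, tau d q z w n 1 = 1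
  | 0 => by
    change Y.lift _ _ = _
    rw [map_one]
  | n + 1 => by rw [tau_succ, cexp_one z w hw, tau_one hw n]

end Trace
end
end Rep
end Algebra

/-! ### The E-system and the specialized trace -/

/-- The quantity `E^{(m)} = (1/d) ∑_s x_{m+s} x_{d-s}`, with subscripts modulo `d`. -/
def ESum {d : ℕ} [NeZero d] (x : ZMod d → ℂ) (m : ZMod d) : ℂ :=
  (1 / (d : ℂ)) * ∑ s : ZMod d, x (m + s) * x (-s)

/-- A solution `x_1, …, x_{d-1}` of the E-system, with subscripts modulo `d` and `x_0 = 1`. -/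
structure ESolution (d : ℕ) [NeZero d] where
  x : ZMod d → ℂ
  x_zero : x 0 = 1
  esystem : ∀ m : ZMod d, m ≠ 0 → ESum x m = x m * ESum x 0

/-- The rules of the specialized trace on the union of the algebras `Y_{d,n}(q)`. A linear map on
the union is a family of linear maps that is compatible with the inclusions. -/
structure IsSpecializedTrace {d : ℕ} [NeZero d] (x : ZMod d → ℂ) (q : ℂˣ)
    (tr : ∀ n, Y ℂ d n q →ₗ[ℂ] ℂ[X]) : Prop where
  tr_incl : ∀ (n : ℕ) (a : Y ℂ d n q), tr (n + 1) (incl d n q a) = tr n a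
  tr_mul_comm : ∀ (n : ℕ) (a b : Y ℂ d n q), tr n (a * b) = tr n (b * a)
  tr_one : ∀ n : ℕ, tr n 1 = 1
  tr_markov : ∀ (n : ℕ) (a : Y ℂ d (n + 1) q),
    tr (n + 2) (incl d (n + 1) q a * g d q ⟨n, by omega⟩) = Polynomial.X * tr (n + 1) a
  tr_framing : ∀ (n : ℕ) (a : Y ℂ d n q) (s : ℕ), 1 ≤ s → s ≤ d - 1 →
    tr (n + 1) (incl d n q a * t d q (Fin.last n) ^ s) = Polynomial.C (x s) * tr n a

section Existence

variable {d : ℕ} [NeZero d] {q : ℂˣ}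

theorem IsSpecializedTrace.unique {x : ZMod d → ℂ} {tr tr' : ∀ n, Y ℂ d n q →ₗ[ℂ] ℂ[X]}
    (h : IsSpecializedTrace x q tr) (h' : IsSpecializedTrace x q tr') : tr = tr' := by
  funext n
  induction n with
  | zero =>
    refine LinearMap.ext fun y => ?_
    have hy : y ∈ (⊥ : Subalgebra ℂ (Y ℂ d 0 q)) :=
      Y.mem_of_gen _ (fun i hi => by omega) (fun i hi => by omega) y
    obtain ⟨r, rfl⟩ := Algebra.mem_bot.1 hy
    rw [Algebra.algebraMap_eq_smul_one, map_smul, map_smul, h.tr_one, h'.tr_one]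
  | succ n ih =>
    refine LinearMap.ext fun y => ?_
    induction y using span_induction with
    | hadd x y hx hy => rw [map_add, map_add, hx, hy]
    | h0 => rw [map_zero, map_zero]
    | ht a c =>
      have key : ∀ s : ZMod d, tr (n + 1) (tT d (n + 1) q n ^ s.val * incl d n q c) =
          tr' (n + 1) (tT d (n + 1) q n ^ s.val * incl d n q c) := fun s => by
        have hs := ZMod.val_lt s
        rw [h.tr_mul_comm, h'.tr_mul_comm, tT_eq n (by omega)]
        rcases Nat.eq_zero_or_pos s.val with h0 | h0
        · rw [h0, pow_zero, mul_one, h.tr_incl, h'.tr_incl, ih]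
        · have e := h.tr_framing n c s.val h0 (by omega)
          have e' := h'.tr_framing n c s.val h0 (by omega)
          rw [ih] at e
          exact e.trans e'.symm
      rw [pB, smul_mul_assoc, map_smul, map_smul, Finset.sum_mul, map_sum, map_sum]
      congr 1
      refine Finset.sum_congr rfl fun s _ => ?_
      rw [smul_mul_assoc, map_smul, map_smul, key]
    | hg hn b c =>
      obtain ⟨k, rfl⟩ : ∃ k, n = k + 1 := ⟨n - 1, by omega⟩
      rw [Nat.add_sub_cancel, h.tr_mul_comm, h'.tr_mul_comm, ← mul_assoc, ← map_mul,
        gT_eq k (by omega)]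
      have e := h.tr_markov k (c * b)
      have e' := h'.tr_markov k (c * b)
      rw [ih] at e
      exact e.trans e'.symm

/-- The parameter `q` as a unit of `ℂ[X]`. -/
def qX (q : ℂˣ) : ℂ[X]ˣ := Units.map (Polynomial.C : ℂ →+* ℂ[X]).toMonoidHom q

/-- Extension of scalars to `ℂ[X]`. -/
theorem isRep_baseChange (n : ℕ) : IsRep (R := ℂ) (B := Y ℂ[X] d n (qX q)) d n
    ((q : ℂ) - ((q⁻¹ : ℂˣ) : ℂ)) (gT d n (qX q))
    (tT d n (qX q)) where
  braid := isRep_Y.braid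
  far := isRep_Y.far
  tt := isRep_Y.tt
  tg0 := isRep_Y.tg0
  tg1 := isRep_Y.tg1
  tg := isRep_Y.tg
  td := isRep_Y.td
  quad i h := by
    have := (isRep_Y (R := ℂ[X]) (d := d) (n := n) (q := qX q)).quad i h
    rw [this]
    have e1 : ∀ y : Y ℂ[X] d n (qX q),
        ((qX q : ℂ[X]) -
          (((qX q)⁻¹ : ℂ[X]ˣ) : ℂ[X])) • y =
          ((q : ℂ) - ((q⁻¹ : ℂˣ) : ℂ)) • y := fun y => by
      have c1 : ((qX q : ℂ[X]ˣ) : ℂ[X]) = Polynomial.C (q : ℂ) := rfl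
      have c2 : (((qX q)⁻¹ : ℂ[X]ˣ) : ℂ[X]) = Polynomial.C ((q⁻¹ : ℂˣ) : ℂ) := rfl
      rw [← algebraMap_smul ℂ[X] ((q : ℂ) - ((q⁻¹ : ℂˣ) : ℂ)) y, c1, c2, ← map_sub]
      rfl
    rw [e1, eB, eB, invd, invd, algebraMap_smul]
    rfl

/-- The weights of the eigenspaces of the framing generators. -/
def weight (x : ZMod d → ℂ) (a : ZMod d) : ℂ :=
  (d : ℂ)⁻¹ * ∑ s : ZMod d, ZMod.stdAddChar (-(s * a)) * x s

theorem sum_weight (x : ZMod d → ℂ) (s : ZMod d) :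
    ∑ a : ZMod d, ZMod.stdAddChar (s * a) * weight x a = x s := by
  have h := congrFun (LinearEquiv.symm_apply_apply (ZMod.dft (N := d) (E := ℂ)) x) s
  rw [ZMod.invDFT_apply] at h
  conv_rhs => rw [← h]
  rw [smul_eq_mul, Finset.mul_sum]
  refine Finset.sum_congr rfl fun a _ => ?_
  rw [weight, ZMod.dft_apply, mul_comm s a]
  simp only [smul_eq_mul]
  ring

theorem exists_specializedTrace {x : ZMod d → ℂ} (hx : x 0 = 1) (q : ℂˣ) :
    ∃ tr, IsSpecializedTrace x q tr := by
  set Q : ℂ[X]ˣ := qX q with hQ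
  let w : ZMod d → ℂ[X] := fun a => Polynomial.C (weight x a)
  have hs : ∀ s : ZMod d, ∑ a, chi ℂ[X] (s * a) * w a = Polynomial.C (x s) := fun s => by
    rw [← sum_weight x s, map_sum]
    refine Finset.sum_congr rfl fun a _ => ?_
    rw [map_mul]; rfl
  have hw : ∑ a, w a = 1 := by
    have := hs 0
    rw [hx, map_one] at this
    rw [← this]
    refine Finset.sum_congr rfl fun a _ => ?_
    rw [zero_mul, chi_zero, one_mul]
  let bc : ∀ n, Y ℂ d n q →ₐ[ℂ] Y ℂ[X] d n Q := fun n => Y.lift (isRep_baseChange n)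
  have hbc : ∀ n a, bc (n + 1) (incl d n q a) = incl d n Q (bc n a) := fun n a => by
    have : (bc (n + 1)).comp (incl d n q) = ((incl d n Q).restrictScalars ℂ).comp (bc n) := by
      refine Y.hom_ext (fun i h => ?_) (fun j h => ?_)
      · change bc (n + 1) (incl d n q _) = incl d n Q (bc n _)
        rw [incl_gT i h]
        change Y.lift _ _ = incl d n Q (Y.lift _ _)
        rw [Y.lift_gT _ i (by omega), Y.lift_gT _ i h, incl_gT i h]
      · change bc (n + 1) (incl d n q _) = incl d n Q (bc n _)
        rw [incl_tT j h]
        change Y.lift _ _ = incl d n Q (Y.lift _ _)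
        rw [Y.lift_tT _ j (by omega), Y.lift_tT _ j h, incl_tT j h]
    exact DFunLike.congr_fun this a
  refine ⟨fun n => ((tau d Q Polynomial.X w n).restrictScalars ℂ).comp (bc n).toLinearMap,
    ⟨fun n a => ?_, fun n a b => ?_, fun n => ?_, fun n a => ?_, fun n a s h1 h2 => ?_⟩⟩
  · change tau d Q Polynomial.X w (n + 1) (bc (n + 1) _) = tau d Q Polynomial.X w n (bc n a)
    rw [hbc, tau_incl _ w hw]
  · change tau d Q Polynomial.X w n (bc n _) = tau d Q Polynomial.X w n (bc n _)
    rw [map_mul (bc n), map_mul (bc n), tracial]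
  · change tau d Q Polynomial.X w n (bc n _) = _
    rw [map_one, tau_one _ w hw]
  · change tau d Q Polynomial.X w (n + 2) (bc (n + 2) _) =
      _ * tau d Q Polynomial.X w (n + 1) (bc (n + 1) a)
    have e : bc (n + 2) (g d q ⟨n, by omega⟩) = gT d (n + 2) Q n := Y.lift_g _ _
    have hg := cexp_g (d := d) (q := Q) Polynomial.X w (show 1 ≤ n + 1 by omega)
    rw [Nat.add_sub_cancel] at hg
    rw [map_mul, hbc, e, tau_succ, cexp_incl_mul, hg, mul_smul_comm, mul_one, map_smul, smul_eq_mul]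
  · change tau d Q Polynomial.X w (n + 1) (bc (n + 1) _) =
      _ * tau d Q Polynomial.X w n (bc n a)
    have e : bc (n + 1) (t d q (Fin.last n)) = tT d (n + 1) Q n := Y.lift_t _ _
    rw [map_mul, hbc, map_pow, e, tau_succ, cexp_incl_mul, cexp_t_pow, mul_smul_comm, mul_one,
      map_smul, smul_eq_mul, hs]

end Existence

section Invariant

variable {d : ℕ} [NeZero d]

/-- The specialized trace `tr_{d,D} : ⋃_n Y_{d,n}(q) → ℂ[z]`: the unique family of maps satisfying
the rules above, for the solution `X_D` of the E-system. -/
def specializedTrace (S : ESolution d) (q : ℂˣ) : ∀ n, Y ℂ d n q →ₗ[ℂ] ℂ[X] :=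
  Classical.choose (exists_specializedTrace S.x_zero q)

theorem specializedTrace_spec (S : ESolution d) (q : ℂˣ) :
    IsSpecializedTrace S.x q (specializedTrace S q) :=
  Classical.choose_spec (exists_specializedTrace S.x_zero q)

/-- The number `E_D = (1/d) ∑_s x_s x_{d-s}`. -/
def ESolution.E (S : ESolution d) : ℂ := ESum S.x 0

/-- `E_D` is the value of the specialized trace at the elements `e_i`. -/
theorem specializedTrace_e (S : ESolution d) (q : ℂˣ) (n : ℕ) :
    specializedTrace S q (n + 2) (mkY ℂ d (n + 2) q (idem ℂ d ⟨n, by omega⟩)) =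
      Polynomial.C S.E := by
  have h := specializedTrace_spec S q
  have hfr : ∀ (n : ℕ) (a : Y ℂ d n q) (s : ZMod d), specializedTrace S q (n + 1)
      (incl d n q a * t d q (Fin.last n) ^ s.val) =
        Polynomial.C (S.x s) * specializedTrace S q n a := fun n a s => by
    rcases Nat.eq_zero_or_pos s.val with h0 | h0
    · rw [h0, pow_zero, mul_one, h.tr_incl, (ZMod.val_eq_zero s).1 h0, S.x_zero, map_one, one_mul]
    · have := ZMod.val_lt s
      rw [h.tr_framing n a s.val h0 (by omega), ZMod.natCast_zmod_val]
  have e1 : (t d q (BraidGen.left (⟨n, by omega⟩ : BraidGen (n + 2))) : Y ℂ d (n + 2) q) =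
      incl d (n + 1) q (t d q (Fin.last n)) := by
    have := incl_tT (R := ℂ) (d := d) (q := q) (n := n + 1) n (by omega)
    rw [tT_eq _ (by omega), tT_eq _ (by omega)] at this
    exact this.symm
  have e2 : ∀ s : ZMod d, specializedTrace S q (n + 2)
      ((t d q (BraidGen.left (⟨n, by omega⟩ : BraidGen (n + 2))) : Y ℂ d (n + 2) q) ^ s.val *
        t d q (BraidGen.right (⟨n, by omega⟩ : BraidGen (n + 2))) ^ (-s).val) =
      Polynomial.C (S.x s * S.x (-s)) := fun s => by
    have h1 := hfr (n + 1) (t d q (Fin.last n) ^ s.val) (-s)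
    have h2 := hfr n 1 s
    rw [map_one, one_mul, h.tr_one, mul_one] at h2
    rw [h2, map_pow, ← e1] at h1
    rw [mul_comm (S.x s), map_mul Polynomial.C]
    exact h1
  rw [mkAlgHom_idem, eB, map_smul, map_sum, Finset.sum_congr rfl fun s _ => e2 s, ← map_sum,
    Polynomial.smul_C, ESolution.E, ESum, invd]
  simp

/-- `λ_D = (z - (q - q⁻¹) E_D) / z`. -/
def lam (S : ESolution d) (q : ℂˣ) (z : ℂ) : ℂ :=
  (z - ((q : ℂ) - ((q⁻¹ : ℂˣ) : ℂ)) * S.E) / z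

/-- The value `Θ_{d,D}(q, z)(α̂) = Λ_D^{n-1} (√λ_D)^{ε(α)} tr_{d,D}(α)` on the closure of a braid
`α ∈ B_n`, where `Λ_D = 1 / (z √λ_D)`. The argument `r` is the chosen square root of `λ_D`. -/
def theta (S : ESolution d) (q : ℂˣ) (z r : ℂ) {n : ℕ} (α : BraidGroup n) : ℂ :=
  (1 / (z * r)) ^ ((n : ℤ) - 1) * r ^ exponentSum α *
    (specializedTrace S q n (braidToY ℂ d n q α)).eval z

/-- The invariant in the variables `q` and `λ_D`, by the change of variables
`z = (q - q⁻¹) E_D / (1 - λ_D)`. The argument `r` is the chosen square root of `l = λ_D`. -/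
def thetaLam (S : ESolution d) (q : ℂˣ) (l r : ℂ) {n : ℕ} (α : BraidGroup n) : ℂ :=
  theta S q (((q : ℂ) - ((q⁻¹ : ℂˣ) : ℂ)) * S.E / (1 - l)) r α

end Invariant

end YH
end

/-! The mirror automorphism of the braid group lifts to the Yokonuma--Hecke algebras, at the price
of replacing `q` by `q⁻¹`. The quadratic relation gives `g_i⁻¹ = g_i - (q - q⁻¹) e_i`, hence
`(g_i⁻¹)² = 1 - (q - q⁻¹) e_i g_i⁻¹`, which is the relation with parameter `q⁻¹`; the idempotent
`e_i` involves only framings and does not change. The remaining relations survive inversion of the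
`g_i`. So there is a homomorphism `mirrorY` from the algebra at `q⁻¹` to the algebra at `q`, and it
carries the image of `α` to the image of its mirror (`IsRep.inverse`, `braidToY_mirror`).

Pull the specialized trace at `q` back along `mirrorY`. Cyclicity, normalization and the framing
rule are inherited without change. Only the Markov rule is affected: it now asks for `tr(a g_n⁻¹) =
z tr(a) - (q - q⁻¹) tr(a e_n)`. The heart of the matter is therefore the factorization `tr(a e_n) =
E_D tr(a)`, proved in `tr_mul_e`. It fails for arbitrary framing values `x` and is exactly what the
E-system provides. It is checked on a spanning set: on `t_n^m c` it is the equation `E^(m) = x_m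
E^(0)`, and on `b g c` it reduces by the Markov rule to the same claim one strand lower. The
pulled-back trace thus obeys the Markov rule with `z - (q - q⁻¹) E_D`. After the substitution `z ↦ z
+ (q - q⁻¹) E_D` it satisfies all the rules at `q⁻¹`, so by uniqueness it is the specialized trace
there (`specializedTrace_mirrorY`).

The normalization then matches by itself. Put `z' = z - (q - q⁻¹) E_D`; then `λ_D z = z'`, so `z
√λ_D = z' / √λ_D` and the two factors `Λ_D` coincide. The exponent sum changes sign under mirroring,
which is compensated by inverting `√λ_D`. In the variables `(q, λ_D)` the map `(q, λ_D) ↦ (q⁻¹,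
λ_D⁻¹)` induces the same `z ↦ z'`. -/

noncomputable section

namespace YH

/-! ### The mirror homomorphism between the algebras at `q⁻¹` and `q` -/

section Inverse

variable {R : Type} [CommRing R] [Algebra ℂ R] {d : ℕ} [NeZero d] {n : ℕ}
  {B : Type} [Ring B] [Algebra R B] {v : R} {gg tt : ℕ → B}

/-- The inverses of the braiding generators, with the same framing generators, satisfy the
relations of the Yokonuma--Hecke algebra with the opposite parameter. -/
theorem IsRep.inverse (H : IsRep d n v gg tt) :
    IsRep d n (-v) (fun i => gg i - v • eB R d (tt i) (tt (i + 1))) tt where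
  braid i h := by
    -- Inverting both sides reverses each word. The two braid words are palindromes, so the relation
    -- is reproduced as it stands. The inverse stored in `H.unit` is by definition the element `g -
    -- v e` of the statement.
    have : H.unit i (by omega) * H.unit (i + 1) h * H.unit i (by omega) =
        H.unit (i + 1) h * H.unit i (by omega) * H.unit (i + 1) h :=
      Units.ext (H.braid i h)
    have := congrArg (fun u : Bˣ => ((u⁻¹ : Bˣ) : B)) this
    simp only [mul_inv_rev, Units.val_mul, ← mul_assoc] at this
    exact this
  far i j h h' := by
    -- Here the reversal exchanges the two sides, hence the final `symm`.
    have : H.unit i (by omega) * H.unit j h' = H.unit j h' * H.unit i (by omega) :=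
      Units.ext (H.far i j h h')
    have := congrArg (fun u : Bˣ => ((u⁻¹ : Bˣ) : B)) this
    simp only [mul_inv_rev, Units.val_mul] at this
    exact this.symm
  tt := H.tt
  tg0 i h := by
    -- Since `g_i` conjugates `t_i` to `t_{i+1}`, its inverse conjugates `t_{i+1}` to `t_i`: each of
    -- `tg0` and `tg1` for the inverses comes from the other one for the generators.
    have : SemiconjBy (H.unit i h : B) (tt i) (tt (i + 1)) := (H.tg1 i h).symm
    exact this.units_inv_symm_left.eq.symm
  tg1 i h := by
    have : SemiconjBy (H.unit i h : B) (tt (i + 1)) (tt i) := (H.tg0 i h).symm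
    exact this.units_inv_symm_left.eq.symm
  tg i j h h' h1 h2 := by
    have : SemiconjBy (H.unit i h : B) (tt j) (tt j) := (H.tg i j h h' h1 h2).symm
    exact this.units_inv_symm_left.eq.symm
  td := H.td
  quad i h := by
    -- Only the left factor of the square is expanded: `g⁻¹ g⁻¹ = (g - v e) g⁻¹ = 1 - v e g⁻¹`.
    have : gg i * (gg i - v • eB R d (tt i) (tt (i + 1))) = 1 := (H.unit i h).val_inv
    rw [sub_mul (gg i), this, smul_mul_assoc, neg_smul, sub_eq_add_neg]

variable {q : Rˣ}

/-- The parameter attached to `q⁻¹` is `q⁻¹ - q = -(q - q⁻¹)`, which is the sign produced by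
inverting the generators. The double inverse of a unit has value `q` by definition, so no further
rewriting is needed. -/
theorem isRep_inverse_Y : IsRep (B := Y R d n q) d n
    (((q⁻¹ : Rˣ) : R) - (((q⁻¹)⁻¹ : Rˣ) : R))
    (fun i => gT d n q i -
      ((q : R) - ((q⁻¹ : Rˣ) : R)) • eB R d (tT d n q i) (tT d n q (i + 1))) (tT d n q) := by
  have := (isRep_Y (R := R) (d := d) (n := n) (q := q)).inverse
  rwa [neg_sub] at this

/-- The homomorphism `Y_{d,n}(q⁻¹) → Y_{d,n}(q)` with `g_i ↦ g_i⁻¹` and `t_j ↦ t_j`. -/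
def mirrorY (R : Type) [CommRing R] [Algebra ℂ R] (d n : ℕ) [NeZero d] (q : Rˣ) :
    Y R d n q⁻¹ →ₐ[R] Y R d n q :=
  Y.lift isRep_inverse_Y

theorem mirrorY_gT (i : ℕ) (h : i + 1 < n) :
    mirrorY R d n q (gT d n q⁻¹ i) = gT d n q i -
      ((q : R) - ((q⁻¹ : Rˣ) : R)) • eB R d (tT d n q i) (tT d n q (i + 1)) :=
  Y.lift_gT _ i h

theorem mirrorY_tT (j : ℕ) (h : j < n) : mirrorY R d n q (tT d n q⁻¹ j) = tT d n q j :=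
  Y.lift_tT _ j h

/-- The trace rules compare consecutive algebras, so pulling a trace back requires the mirror maps
to commute with adding a strand. This holds because the formula `g_i - (q - q⁻¹) e_i` does not
depend on the number of strands. -/
theorem mirrorY_incl (a : Y R d n q⁻¹) :
    mirrorY R d (n + 1) q (incl d n q⁻¹ a) = incl d n q (mirrorY R d n q a) := by
  have : (mirrorY R d (n + 1) q).comp (incl d n q⁻¹) = (incl d n q).comp (mirrorY R d n q) := by
    refine Y.hom_ext (fun i h => ?_) (fun j h => ?_)
    · rw [AlgHom.comp_apply, AlgHom.comp_apply, incl_gT i h, mirrorY_gT i h,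
        mirrorY_gT i (by omega), map_sub, map_smul, map_eB, incl_gT i h, incl_tT i (by omega),
        incl_tT (i + 1) h]
    · rw [AlgHom.comp_apply, AlgHom.comp_apply, incl_tT j h, mirrorY_tT j h,
        mirrorY_tT j (by omega), incl_tT j h]
  exact DFunLike.congr_fun this a

/-- Both sides are multiplicative in `α`, so it suffices to compare them on `σ_i`, where both are
the inverse of `g_i`. -/
theorem braidToY_mirror (α : BraidGroup n) :
    braidToY R d n q (mirror n α) = mirrorY R d n q (braidToY R d n q⁻¹ α) := by
  have : (braidToY R d n q).comp (mirror n) =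
      (mirrorY R d n q : Y R d n q⁻¹ →* Y R d n q).comp (braidToY R d n q⁻¹) := by
    refine MonoidHom.eq_of_eqOn_dense (PresentedGroup.closure_range_of _) ?_
    rintro _ ⟨i, rfl⟩
    change braidToY R d n q (mirror n (σ i)) = mirrorY R d n q (braidToY R d n q⁻¹ (σ i))
    have hg : ∀ p : Rˣ, braidToY R d n p (σ i) = gT d n p i.1 := fun p => by
      rw [gT_eq _ i.2, braidToY, MonoidHom.comp_apply, braidToFramed, BraidGroup.lift_σ]
      rfl
    -- The algebra is only a monoid under multiplication, so the image of `σ_i⁻¹` is identified by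
    -- uniqueness of inverses: it is a left inverse of `g_i`, while `g_i - (q - q⁻¹) e_i` is a right
    -- inverse.
    have h1 : braidToY R d n q (σ i)⁻¹ * braidToY R d n q (σ i) = 1 := by
      rw [← map_mul, inv_mul_cancel, map_one]
    rw [hg] at h1
    rw [hg, mirrorY_gT _ i.2, mirror, BraidGroup.lift_σ]
    exact left_inv_eq_right_inv h1 (isRep_Y.unit i.1 i.2).val_inv
  exact DFunLike.congr_fun this α

end Inverse

/-! ### The E-condition for the specialized trace -/

section Invariant

variable {d : ℕ} [NeZero d] {q : ℂˣ} {x : ZMod d → ℂ} {tr : ∀ n, Y ℂ d n q →ₗ[ℂ] ℂ[X]}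

namespace IsSpecializedTrace

/-- The framing rule is imposed only for exponents `1, …, d - 1`. The convention `x 0 = 1` together
with compatibility with the inclusions covers the residue `0`, so that sums over all of `ZMod d` can
be treated uniformly. -/
theorem framing_val (h : IsSpecializedTrace x q tr) (hx : x 0 = 1) (n : ℕ) (a : Y ℂ d n q)
    (s : ZMod d) : tr (n + 1) (incl d n q a * tT d (n + 1) q n ^ s.val) =
      Polynomial.C (x s) * tr n a := by
  rw [tT_eq n (by omega)]
  rcases Nat.eq_zero_or_pos s.val with h0 | h0
  · rw [h0, pow_zero, mul_one, h.tr_incl, (ZMod.val_eq_zero s).1 h0, hx, map_one, one_mul]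
  · have := ZMod.val_lt s
    have := h.tr_framing n a s.val h0 (by omega)
    rwa [ZMod.natCast_zmod_val] at this

theorem markov_gT (h : IsSpecializedTrace x q tr) (n : ℕ) (a : Y ℂ d (n + 1) q) :
    tr (n + 2) (incl d (n + 1) q a * gT d (n + 2) q n) = Polynomial.X * tr (n + 1) a := by
  rw [gT_eq n (by omega)]
  exact h.tr_markov n a

/-- In each term `t_n^s t_{n+1}^{-s}` of `e_n` the factor on the new strand is removed by the
framing rule, and `t_n^s` is absorbed into the smaller algebra. No E-system is used; the formula is
applied in both directions in `tr_mul_e`. -/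
theorem tr_mul_e_eq_sum (h : IsSpecializedTrace x q tr) (hx : x 0 = 1) (n : ℕ)
    (a : Y ℂ d (n + 1) q) :
    tr (n + 2) (incl d (n + 1) q a * eB ℂ d (tT d (n + 2) q n) (tT d (n + 2) q (n + 1))) =
      invd ℂ d • ∑ s : ZMod d,
        Polynomial.C (x (-s)) * tr (n + 1) (a * tT d (n + 1) q n ^ s.val) := by
  rw [eB, mul_smul_comm, map_smul, Finset.mul_sum, map_sum]
  congr 1
  refine Finset.sum_congr rfl fun s _ => ?_
  rw [← incl_tT n (by omega), ← map_pow, ← mul_assoc, ← map_mul, h.framing_val hx]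

/-- This is where the E-system enters. For `t_n^m c` the sum of `tr_mul_e_eq_sum` becomes `(1/d) ∑_s
x_{-s} x_{m+s} tr(c) = E^(m) tr(c)`, whereas the right-hand side is `E^(0) x_m tr(c)`. -/
theorem tr_framing_mul_e (h : IsSpecializedTrace x q tr) (hx : x 0 = 1)
    (hE : ∀ m, m ≠ 0 → ESum x m = x m * ESum x 0) (n : ℕ) (m : ZMod d) (c : Y ℂ d n q) :
    tr (n + 2) (incl d (n + 1) q (tT d (n + 1) q n ^ m.val * incl d n q c) *
        eB ℂ d (tT d (n + 2) q n) (tT d (n + 2) q (n + 1))) =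
      Polynomial.C (ESum x 0) * tr (n + 1) (tT d (n + 1) q n ^ m.val * incl d n q c) := by
  -- The E-system omits `m = 0`, where the equation is trivial because `x 0 = 1`.
  have hm : ESum x m = x m * ESum x 0 := by
    rcases eq_or_ne m 0 with rfl | h0
    · rw [hx, one_mul]
    · exact hE m h0
  -- Cyclicity brings `t_n^m` behind `t_n^s`, and the two powers merge into a single framing `m + s`
  -- on the last strand, to which the framing rule applies.
  have e : ∀ s : ZMod d,
      tr (n + 1) (tT d (n + 1) q n ^ m.val * incl d n q c * tT d (n + 1) q n ^ s.val) =
        Polynomial.C (x (m + s)) * tr n c := fun s => by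
    rw [mul_assoc, h.tr_mul_comm, mul_assoc, ← pow_val_add (isRep_Y.td n (by omega)), add_comm s m,
      h.framing_val hx]
  rw [h.tr_mul_e_eq_sum hx, h.tr_mul_comm (n + 1), h.framing_val hx,
    Finset.sum_congr rfl fun s _ => by rw [e s, ← mul_assoc, ← map_mul], ← Finset.sum_mul,
    ← map_sum, ← smul_mul_assoc, Polynomial.smul_C, ← mul_assoc, ← map_mul, mul_comm (ESum x 0),
    ← hm, ESum, smul_eq_mul, one_div]
  simp only [mul_comm (x (m + _))]
  rfl

/-- The eigenprojection is a linear combination of powers of `t_n`, so this follows by linearity. It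
puts the previous result in the form required by `span_induction`. -/
theorem tr_pB_mul_e (h : IsSpecializedTrace x q tr) (hx : x 0 = 1)
    (hE : ∀ m, m ≠ 0 → ESum x m = x m * ESum x 0) (n : ℕ) (a : ZMod d) (c : Y ℂ d n q) :
    tr (n + 2) (incl d (n + 1) q (pB ℂ (tT d (n + 1) q n) a * incl d n q c) *
        eB ℂ d (tT d (n + 2) q n) (tT d (n + 2) q (n + 1))) =
      Polynomial.C (ESum x 0) * tr (n + 1) (pB ℂ (tT d (n + 1) q n) a * incl d n q c) := by
  simp only [pB, smul_mul_assoc, Finset.sum_mul, map_smul, map_sum, h.tr_framing_mul_e hx hE,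
    mul_smul_comm, Finset.mul_sum]

/-- The E-condition: the idempotents `e_i` factor out of the specialized trace. -/
theorem tr_mul_e (h : IsSpecializedTrace x q tr) (hx : x 0 = 1)
    (hE : ∀ m, m ≠ 0 → ESum x m = x m * ESum x 0) (n : ℕ) (a : Y ℂ d (n + 1) q) :
    tr (n + 2) (incl d (n + 1) q a * eB ℂ d (tT d (n + 2) q n) (tT d (n + 2) q (n + 1))) =
      Polynomial.C (ESum x 0) * tr (n + 1) a := by
  induction n with
  | zero =>
    induction a using span_induction with
    | hadd a b ha hb => rw [map_add, add_mul, map_add, ha, hb, map_add, mul_add]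
    | h0 => rw [map_zero, zero_mul, map_zero, map_zero, mul_zero]
    | ht a c => exact h.tr_pB_mul_e hx hE 0 a c
    -- On one strand there is no braiding generator: this family of spanning elements is empty.
    | hg hn => omega
  | succ n ih =>
    induction a using span_induction with
    | hadd a b ha hb => rw [map_add, add_mul, map_add, ha, hb, map_add, mul_add]
    | h0 => rw [map_zero, zero_mul, map_zero, map_zero, mul_zero]
    | ht a c => exact h.tr_pB_mul_e hx hE (n + 1) a c
    -- With `b`, `c` in the algebra on `n + 1` strands, the claim for `b g_n c` and `e_{n+1}`
    -- reduces to the claim for `c b` and `e_n`: a framing on the last strand slides through `c` and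
    -- then through `g_n`, which moves it to the preceding strand, and the Markov rule removes
    -- `g_n`.
    | hg hn b c =>
      rw [Nat.add_sub_cancel]
      -- Cyclicity brings `c` to the front, after which `g_n` is at the end and the Markov rule
      -- applies. The slot `y` is used for `1` and for powers of `t_n`.
      have key : ∀ y : Y ℂ d (n + 1) q,
          tr (n + 2) (incl d (n + 1) q b * incl d (n + 1) q y * gT d (n + 2) q n *
            incl d (n + 1) q c) = Polynomial.X * tr (n + 1) (c * b * y) := fun y => by
        rw [h.tr_mul_comm, ← mul_assoc, ← mul_assoc, ← map_mul, ← map_mul, h.markov_gT]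
      have e : ∀ s : ZMod d,
          tr (n + 2) (incl d (n + 1) q b * gT d (n + 2) q n * incl d (n + 1) q c *
              tT d (n + 2) q (n + 1) ^ s.val) =
            Polynomial.X * tr (n + 1) (c * b * tT d (n + 1) q n ^ s.val) := fun s => by
        have h1 : SemiconjBy (gT d (n + 2) q n : Y ℂ d (n + 2) q) (tT d (n + 2) q (n + 1))
            (tT d (n + 2) q n) := (isRep_Y.tg0 n (by omega)).symm
        rw [← key, map_pow, incl_tT n (by omega), mul_assoc _ (incl d (n + 1) q c),
          ← ((t_commute_incl c).pow_left s.val).eq, ← mul_assoc, mul_assoc (incl d (n + 1) q b),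
          (h1.pow_right s.val).eq, ← mul_assoc]
      have k1 := key 1
      rw [map_one, mul_one, mul_one] at k1
      -- The induction hypothesis is read backwards: `E tr(c b)` on the right becomes `tr(c b e_n)`.
      -- Then both sides are sums over framings, and they agree term by term through `e`.
      rw [h.tr_mul_e_eq_sum hx, k1, mul_left_comm, ← ih (c * b), h.tr_mul_e_eq_sum hx,
        mul_smul_comm, Finset.mul_sum]
      congr 1
      refine Finset.sum_congr rfl fun s _ => ?_
      rw [e, mul_left_comm]

end IsSpecializedTrace

/-! ### Comparison of the traces and of the invariants under mirroring -/

/-- The specialized trace for `q⁻¹` is obtained from the one for `q` along `g_i ↦ g_i⁻¹`, by the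
change of variable `z ↦ z + (q - q⁻¹) E_D`. -/
theorem specializedTrace_mirrorY (S : ESolution d) (q : ℂˣ) (n : ℕ) (a : Y ℂ d n q⁻¹) :
    (specializedTrace S q n (mirrorY ℂ d n q a)).comp
        (Polynomial.X + Polynomial.C (((q : ℂ) - ((q⁻¹ : ℂˣ) : ℂ)) * S.E)) =
      specializedTrace S q⁻¹ n a := by
  set c : ℂ := ((q : ℂ) - ((q⁻¹ : ℂˣ) : ℂ)) * S.E with hc
  have h := specializedTrace_spec S q
  -- The candidate for the trace at `q⁻¹`: the pullback along `mirrorY` followed by the substitution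
  -- `X ↦ X + c`. Once it satisfies the rules, uniqueness identifies it.
  have H : IsSpecializedTrace S.x q⁻¹ fun n =>
      (Polynomial.aeval (R := ℂ) (Polynomial.X + Polynomial.C c)).toLinearMap ∘ₗ
        specializedTrace S q n ∘ₗ (mirrorY ℂ d n q).toLinearMap := by
    refine ⟨fun n a => ?_, fun n a b => ?_, fun n => ?_, fun n a => ?_, fun n a s h1 h2 => ?_⟩
    all_goals
      simp only [LinearMap.comp_apply, AlgHom.toLinearMap_apply, map_mul, map_one, mirrorY_incl]
    · rw [h.tr_incl]
    · rw [h.tr_mul_comm]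
    · rw [h.tr_one, map_one]
    -- The Markov rule for `g_n` and the E-condition for `e_n` give the factor `X - c` for `g_n⁻¹`;
    -- the substitution `X ↦ X + c` turns it back into `X`.
    · rw [← gT_eq n (by omega), mirrorY_gT n (by omega), mul_sub, mul_smul_comm, map_sub, map_smul,
        h.markov_gT, h.tr_mul_e S.x_zero S.esystem, ← smul_mul_assoc, Polynomial.smul_C,
        smul_eq_mul, ← ESolution.E, ← hc, ← sub_mul, map_mul]
      congr 1
      simp
    -- Framings are fixed by `mirrorY`, and the values `x s` are constant polynomials, hence fixed
    -- by the substitution.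
    · rw [map_pow, Fin.last, ← tT_eq n (by omega), mirrorY_tT n (by omega), tT_eq n (by omega)]
      have := h.tr_framing n (mirrorY ℂ d n q a) s h1 h2
      simp only [Fin.last] at this
      rw [this, map_mul]
      simp
  exact DFunLike.congr_fun (congrFun (H.unique (specializedTrace_spec S q⁻¹)) n) a

theorem specializedTrace_mirror (S : ESolution d) (q : ℂˣ) {n : ℕ} (α : BraidGroup n) (z : ℂ) :
    (specializedTrace S q n (braidToY ℂ d n q (mirror n α))).eval z =
      (specializedTrace S q⁻¹ n (braidToY ℂ d n q⁻¹ α)).eval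
        (z - ((q : ℂ) - ((q⁻¹ : ℂˣ) : ℂ)) * S.E) := by
  -- The right-hand side becomes the trace at `q` of the mirrored braid with `X + c` substituted,
  -- evaluated at `z - c`; the two shifts cancel.
  rw [← specializedTrace_mirrorY, ← braidToY_mirror]
  simp

theorem exponentSum_mirror {n : ℕ} (α : BraidGroup n) :
    exponentSum (mirror n α) = -exponentSum α := by
  have : (exponentSumHom n).comp (mirror n) = (exponentSumHom n)⁻¹ := by
    refine PresentedGroup.ext fun i => ?_
    change exponentSumHom n (mirror n (σ i)) = (exponentSumHom n (σ i))⁻¹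
    rw [mirror, BraidGroup.lift_σ, map_inv]
  exact congrArg Multiplicative.toAdd (DFunLike.congr_fun this α)

/-- The three factors of `theta` match separately. The hypothesis says that the two normalizations
`Λ_D` agree; the opposite exponent sum turns the power of `r` into the same power of `r⁻¹`; the
traces agree by `specializedTrace_mirror`. Neither `z` nor `r` is required to be nonzero, so both
parts of the proposition follow from this single statement. -/
theorem theta_mirror (S : ESolution d) (q : ℂˣ) (z r : ℂ) {n : ℕ} (α : BraidGroup n)
    (h : z * r = (z - ((q : ℂ) - ((q⁻¹ : ℂˣ) : ℂ)) * S.E) * r⁻¹) :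
    theta S q z r (mirror n α) =
      theta S q⁻¹ (z - ((q : ℂ) - ((q⁻¹ : ℂˣ) : ℂ)) * S.E) r⁻¹ α := by
  rw [theta, theta, specializedTrace_mirror, exponentSum_mirror, ← h, inv_zpow']

end Invariant

end YH

end

/-! ### The proposition in the variables `(q, z)` and `(q, λ_D)` -/

theorem mainTheorem6 {d : ℕ} [NeZero d] (S : YH.ESolution d) {n : ℕ} (α : YH.BraidGroup n) :
    (∀ (q : ℂˣ) (z r : ℂ), z ≠ 0 → z - ((q : ℂ) - ((q⁻¹ : ℂˣ) : ℂ)) * S.E ≠ 0 →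
      r ^ 2 = YH.lam S q z →
      r⁻¹ ^ 2 = YH.lam S q⁻¹ (z - ((q : ℂ) - ((q⁻¹ : ℂˣ) : ℂ)) * S.E) ∧
      YH.theta S q z r (YH.mirror n α) =
        YH.theta S q⁻¹ (z - ((q : ℂ) - ((q⁻¹ : ℂˣ) : ℂ)) * S.E) r⁻¹ α) ∧
    (∀ (q : ℂˣ) (l r : ℂ), (q : ℂ) ^ 2 ≠ 1 → l ≠ 0 → l ≠ 1 → r ^ 2 = l →
      YH.thetaLam S q l r (YH.mirror n α) = YH.thetaLam S q⁻¹ l⁻¹ r⁻¹ α) := by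
  refine ⟨fun q z r hz hz' hr => ?_, fun q l r _ hl hl1 hr => ?_⟩
  · have hr0 : r ≠ 0 := by
      rintro rfl
      rw [YH.lam, zero_pow two_ne_zero, eq_comm, div_eq_zero_iff] at hr
      exact hr.elim hz' hz
    refine ⟨?_, YH.theta_mirror S q z r α ?_⟩
    -- Replacing `q` by `q⁻¹` changes the sign of `(q - q⁻¹) E_D`, so the numerator of the new `λ_D`
    -- is again `z` and its denominator is the numerator of the old one.
    · rw [inv_pow, hr, YH.lam, YH.lam, inv_div, inv_inv]
      congr 1
      ring
    -- After clearing denominators `hr` reads `r² z = z - (q - q⁻¹) E_D`; dividing by `r` gives the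
    -- condition of `theta_mirror`.
    · rw [YH.lam, eq_div_iff hz] at hr
      rw [← hr]
      field_simp
  · have hr0 : r ≠ 0 := by
      rintro rfl
      exact hl (by rw [← hr, zero_pow two_ne_zero])
    have h1 : 1 - l ≠ 0 := sub_ne_zero.2 hl1.symm
    have h2 : l - 1 ≠ 0 := sub_ne_zero.2 hl1
    have h3 : 1 - l⁻¹ ≠ 0 := sub_ne_zero.2 fun h => hl1 (inv_eq_one.1 h.symm)
    set v : ℂ := ((q : ℂ) - ((q⁻¹ : ℂˣ) : ℂ)) * S.E with hv
    -- Here `v` includes the factor `E_D`. The change of variables at `(q⁻¹, l⁻¹)` yields `-v / (1 -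
    -- l⁻¹) = v l / (1 - l)`, which is the shifted parameter `z - v` for `z = v / (1 - l)`.
    have hz : (((q⁻¹ : ℂˣ) : ℂ) - (((q⁻¹)⁻¹ : ℂˣ) : ℂ)) * S.E / (1 - l⁻¹) = v / (1 - l) - v := by
      rw [inv_inv, ← neg_sub, neg_mul, ← hv]
      field_simp
      ring
    rw [YH.thetaLam, YH.thetaLam, hz]
    refine YH.theta_mirror S q _ r α ?_
    rw [← hv]
    -- This is `z - v = l z`. With `l = r²` it gives the condition of `theta_mirror` directly,
    -- without first showing `z ≠ 0`, that is, without the nonvanishing of `E_D`.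
    have : v / (1 - l) - v = l * (v / (1 - l)) := by
      field_simp
      ring
    rw [this, ← hr]
    field_simp
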